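/- Let $k$ be a field with $\operatorname{char}(k)=0$, let $V$ be a $k$-vector space (of arbitrary dimension), let $R$ be a subspace of $V\otimes V$ (with $\otimes=\otimes_k$), and let $A=T(V)/(R)$ be the corresponding quadratic algebra. Put $W_0=k$, $W_1=V$ and $W_p=\bigcap_{i+2+j=p}V^{\otimes i}\otimes R\otimes V^{\otimes j}\subseteq V^{\otimes p}$ for $p\ge 2$; elements of $W_p$ are written as (sums of) products $x_1\cdots x_p$ with $x_i\in V$. The algebra $A$ is called Koszul if the complex $K(A)$ with $K(A)_p=A\otimes W_p\otimes A$ and differential $$d(a\otimes x_1\cdots x_p\otimes a')=ax_1\otimes x_2\cdots x_p\otimes a'+(-1)^p\,a\otimes x_1\cdots x_{p-1}\otimes x_pa'$$ (with $d=0$ on $K(A)_0$) has zero homology in every positive degree. The Koszul homology $HK_\bullet(A)$ is the homology of the complex $(A\otimes W_\bullet,b_K)$, where $$b_K(a\otimes x_1\cdots x_p)=ax_1\otimes x_2\cdots x_p+(-1)^p\,x_pa\otimes x_1\cdots x_{p-1}\quad(p\ge 1),$$ and $b_K=0$ on $A\otimes W_0$. Let $e_A:V\to A$, $e_A(x)=x$,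 be the fundamental $1$-cocycle. The left Koszul cap product with $e_A$, $$e_A\underset{K}{\frown}(a\otimes x_1\cdots x_p)=(-1)^{p-1}\,x_pa\otimes x_1\cdots x_{p-1}\quad(p\ge1),$$ which is zero on $A\otimes W_0$, passes to homology and defines a differential $\overline{e}_A\underset{K}{\frown}-:HK_p(A)\to HK_{p-1}(A)$. The higher Koszul homology $HK^{hi}_\bullet(A)$ is the homology of the complex $(HK_\bullet(A),\ \overline{e}_A\underset{K}{\frown}-)$. **Theorem.** There is an isomorphism of $k$-vector spaces $HK^{hi}_0(A)\cong k$. If moreover $A$ is Koszul, then $HK^{hi}_p(A)=0$ for all $p>0$. -/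

import Mathlib

open scoped TensorProduct

noncomputable section

namespace Quadratic

/-! ### Homology of a sequence of linear maps `⋯ → C (p+1) → C p → ⋯ → C 0 → 0` -/

section Homology

variable {k : Type*} [Field k] (C : ℕ → Type*) [∀ p, AddCommGroup (C p)] [∀ p, Module k (C p)]

/-- The cycles: everything in degree `0`, the kernel of the differential in positive degree. -/
def cycles (d : ∀ p, C (p + 1) →ₗ[k] C p) : ∀ p, Submodule k (C p)
  | 0 => ⊤
  | p + 1 => LinearMap.ker (d p)

/-- The boundaries: the range of the incoming differential. -/
def boundaries (d : ∀ p, C (p + 1) →ₗ[k] C p) (p : ℕ) : Submodule k (C p) :=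
  LinearMap.range (d p)

/-- The homology in degree `p`: cycles modulo boundaries (used only when `d ∘ d = 0`). -/
abbrev Homology (d : ∀ p, C (p + 1) →ₗ[k] C p) (p : ℕ) : Type _ :=
  cycles C d p ⧸ (boundaries C d p).submoduleOf (cycles C d p)

end Homology

variable {k : Type*} [Field k] {V : Type*} [AddCommGroup V] [Module k V]

/-! ### First and last letters in the tensor algebra -/

/-- Auxiliary: `v` sends `(t, s)` to `(v t, v ⊗ t)`. -/
def splitLAux : TensorAlgebra k V →ₐ[k]
    Module.End k (TensorAlgebra k V × (V ⊗[k] TensorAlgebra k V)) :=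
  TensorAlgebra.lift k <| LinearMap.mk₂ k
    (fun (v : V) (x : TensorAlgebra k V × (V ⊗[k] TensorAlgebra k V)) =>
      (TensorAlgebra.ι k v * x.1, v ⊗ₜ[k] x.1))
    (by intros; simp [add_mul, TensorProduct.add_tmul])
    (by intros; simp [TensorProduct.smul_tmul'])
    (by intros; simp [mul_add, TensorProduct.tmul_add])
    (by intros; simp)

/-- `x₁ x₂ ⋯ xₚ ↦ x₁ ⊗ x₂ ⋯ xₚ`, and `1 ↦ 0`. -/
def splitL : TensorAlgebra k V →ₗ[k] V ⊗[k] TensorAlgebra k V :=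
  LinearMap.snd k _ _ ∘ₗ LinearMap.applyₗ (1, 0) ∘ₗ splitLAux.toLinearMap

/-- Auxiliary: `v` sends `(t, s)` to `(t v, t ⊗ v)`, acting from the right. -/
def splitRAux : TensorAlgebra k V →ₐ[k]
    (Module.End k (TensorAlgebra k V × (TensorAlgebra k V ⊗[k] V)))ᵐᵒᵖ :=
  TensorAlgebra.lift k <| (MulOpposite.opLinearEquiv k).toLinearMap ∘ₗ LinearMap.mk₂ k
    (fun (v : V) (x : TensorAlgebra k V × (TensorAlgebra k V ⊗[k] V)) =>
      (x.1 * TensorAlgebra.ι k v, x.1 ⊗ₜ[k] v))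
    (by intros; simp [mul_add, TensorProduct.tmul_add])
    (by intros; simp)
    (by intros; simp [add_mul, TensorProduct.add_tmul])
    (by intros; simp [TensorProduct.smul_tmul'])

/-- `x₁ ⋯ xₚ₋₁ xₚ ↦ x₁ ⋯ xₚ₋₁ ⊗ xₚ`, and `1 ↦ 0`. -/
def splitR : TensorAlgebra k V →ₗ[k] TensorAlgebra k V ⊗[k] V :=
  LinearMap.snd k _ _ ∘ₗ LinearMap.applyₗ (1, 0) ∘ₗ
    (MulOpposite.opLinearEquiv k).symm.toLinearMap ∘ₗ splitRAux.toLinearMap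

theorem splitLAux_ι (v : V) (x : TensorAlgebra k V × (V ⊗[k] TensorAlgebra k V)) :
    splitLAux (TensorAlgebra.ι k v) x = (TensorAlgebra.ι k v * x.1, v ⊗ₜ[k] x.1) := by
  rw [splitLAux, TensorAlgebra.lift_ι_apply]
  rfl

theorem splitLAux_fst (t : TensorAlgebra k V) :
    ∀ x : TensorAlgebra k V × (V ⊗[k] TensorAlgebra k V), (splitLAux t x).1 = t * x.1 := by
  induction t using TensorAlgebra.induction with
  | algebraMap r => intro x; simp [Module.algebraMap_end_apply, Algebra.smul_def]
  | ι v => intro x; simp [splitLAux_ι]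
  | mul a b ha hb => intro x; simp [ha, hb, mul_assoc]
  | add a b ha hb => intro x; simp [ha, hb, add_mul]

theorem splitL_one : splitL (1 : TensorAlgebra k V) = 0 := by
  simp [splitL]

theorem splitL_ι_mul (v : V) (t : TensorAlgebra k V) :
    splitL (TensorAlgebra.ι k v * t) = v ⊗ₜ[k] t := by
  simp [splitL, splitLAux_ι, splitLAux_fst]

theorem splitRAux_ι (v : V) (x : TensorAlgebra k V × (TensorAlgebra k V ⊗[k] V)) :
    (splitRAux (TensorAlgebra.ι k v)).unop x = (x.1 * TensorAlgebra.ι k v, x.1 ⊗ₜ[k] v) := by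
  rw [splitRAux, TensorAlgebra.lift_ι_apply]
  rfl

theorem splitRAux_fst (t : TensorAlgebra k V) :
    ∀ x : TensorAlgebra k V × (TensorAlgebra k V ⊗[k] V),
      ((splitRAux t).unop x).1 = x.1 * t := by
  induction t using TensorAlgebra.induction with
  | algebraMap r =>
    intro x
    simp [Module.algebraMap_end_apply, MulOpposite.algebraMap_apply, Algebra.smul_def,
      Algebra.commutes]
  | ι v => intro x; simp [splitRAux_ι]
  | mul a b ha hb => intro x; simp [ha, hb, mul_assoc]
  | add a b ha hb => intro x; simp [ha, hb, mul_add]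

theorem splitR_one : splitR (1 : TensorAlgebra k V) = 0 := by
  simp [splitR]

theorem splitR_mul_ι (t : TensorAlgebra k V) (v : V) :
    splitR (t * TensorAlgebra.ι k v) = t ⊗ₜ[k] v := by
  simp [splitR, splitRAux_ι, splitRAux_fst]

/-! ### The quadratic algebra `A = T(V)/(R)` and the spaces `W_p` -/

/-- The weight-one part `V` of the tensor algebra. -/
abbrev letters (k V : Type*) [Field k] [AddCommGroup V] [Module k V] :
    Submodule k (TensorAlgebra k V) :=
  LinearMap.range (TensorAlgebra.ι k : V →ₗ[k] TensorAlgebra k V)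

/-- The identification of `V ⊗ V` with the weight-two part of the tensor algebra. -/
def mulTwo (k V : Type*) [Field k] [AddCommGroup V] [Module k V] :
    V ⊗[k] V →ₗ[k] TensorAlgebra k V :=
  LinearMap.mul' k (TensorAlgebra k V) ∘ₗ
    TensorProduct.map (TensorAlgebra.ι k) (TensorAlgebra.ι k)

/-- The space of relations `R ⊆ V ⊗ V`, seen in weight two of the tensor algebra. -/
def relations (R : Submodule k (V ⊗[k] V)) : Submodule k (TensorAlgebra k V) :=
  R.map (mulTwo k V)

/-- The quadratic algebra `A = T(V)/(R)`: the quotient of the tensor algebra by the two-sided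
ideal generated by `R`. -/
def QAlg (R : Submodule k (V ⊗[k] V)) : Type _ :=
  RingQuot (fun a b : TensorAlgebra k V => a ∈ relations R ∧ b = 0)

instance (R : Submodule k (V ⊗[k] V)) : Ring (QAlg R) :=
  inferInstanceAs (Ring (RingQuot _))

instance (R : Submodule k (V ⊗[k] V)) : Algebra k (QAlg R) :=
  inferInstanceAs (Algebra k (RingQuot _))

/-- The projection `T(V) → A`. -/
def QAlg.proj (R : Submodule k (V ⊗[k] V)) : TensorAlgebra k V →ₐ[k] QAlg R :=
  RingQuot.mkAlgHom k (fun a b : TensorAlgebra k V => a ∈ relations R ∧ b = 0)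

theorem QAlg.proj_relations (R : Submodule k (V ⊗[k] V)) {r : TensorAlgebra k V}
    (hr : r ∈ relations R) : QAlg.proj R r = 0 := by
  have h := RingQuot.mkAlgHom_rel k (s := fun a b : TensorAlgebra k V => a ∈ relations R ∧ b = 0)
    (x := r) (y := 0) ⟨hr, rfl⟩
  rw [map_zero] at h
  exact h

/-- The fundamental Koszul `1`-cochain `e_A : V → A`, `e_A(x) = x`. -/
def eA (R : Submodule k (V ⊗[k] V)) : V →ₗ[k] QAlg R :=
  (QAlg.proj R).toLinearMap ∘ₗ TensorAlgebra.ι k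

/-- `W_0 = k`, `W_1 = V` and `W_p = ⋂_{i+2+j=p} V^{⊗i} ⊗ R ⊗ V^{⊗j}` for `p ≥ 2`, inside the
tensor algebra, where `⊗` of subspaces is their product. -/
def W (R : Submodule k (V ⊗[k] V)) : ℕ → Submodule k (TensorAlgebra k V)
  | 0 => 1
  | 1 => letters k V
  | p + 2 => ⨅ (i : ℕ) (j : ℕ) (_ : i + 2 + j = p + 2),
      letters k V ^ i * relations R * letters k V ^ j

theorem relations_le (R : Submodule k (V ⊗[k] V)) :
    relations R ≤ letters k V * letters k V := by
  rintro _ ⟨s, -, rfl⟩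
  induction s using TensorProduct.induction_on with
  | zero => simp
  | tmul x y => exact Submodule.mul_mem_mul ⟨x, rfl⟩ ⟨y, rfl⟩
  | add a b ha hb => rw [map_add]; exact add_mem ha hb

theorem W_le (R : Submodule k (V ⊗[k] V)) {p i j : ℕ} (h : i + 2 + j = p) :
    W R p ≤ letters k V ^ i * relations R * letters k V ^ j := by
  obtain ⟨q, rfl⟩ : ∃ q, p = q + 2 := ⟨i + j, by omega⟩
  exact iInf_le_of_le i (iInf_le_of_le j (iInf_le _ h))

theorem W_le_left (R : Submodule k (V ⊗[k] V)) (p : ℕ) :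
    W R (p + 2) ≤ relations R * letters k V ^ p := by
  simpa using W_le R (i := 0) (j := p) (p := p + 2) (by omega)

theorem W_le_right (R : Submodule k (V ⊗[k] V)) (p : ℕ) :
    W R (p + 2) ≤ letters k V ^ p * relations R := by
  simpa using W_le R (i := p) (j := 0) (p := p + 2) (by omega)

theorem W_le_ends (R : Submodule k (V ⊗[k] V)) (p : ℕ) :
    W R (p + 2) ≤ letters k V * (letters k V ^ p * letters k V) := by
  refine (W_le_left R p).trans ((mul_le_mul_left (relations_le R) _).trans (le_of_eq ?_))
  rw [mul_assoc, ← pow_succ', ← pow_succ]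

/-- A tensor all of whose contractions lie in `S` comes from `V ⊗ S`. -/
theorem mem_range_lTensor {M : Type*} [AddCommGroup M] [Module k M] (S : Submodule k M)
    (z : V ⊗[k] M) (h : ∀ f : V →ₗ[k] k, TensorProduct.lid k M (f.rTensor M z) ∈ S) :
    z ∈ LinearMap.range (S.subtype.lTensor V) := by
  classical
  rw [← (lTensor_exact V (LinearMap.exact_subtype_mkQ S) S.mkQ_surjective).linearMap_ker_eq,
    LinearMap.mem_ker]
  have h1 : ∀ (f : V →ₗ[k] k) (z : V ⊗[k] M),
      TensorProduct.lid k _ (f.rTensor (M ⧸ S) (S.mkQ.lTensor V z))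
        = S.mkQ (TensorProduct.lid k M (f.rTensor M z)) := by
    intro f z
    induction z using TensorProduct.induction_on with
    | zero => simp
    | tmul x y => simp
    | add a b ha hb => simp only [map_add, ha, hb]
  apply (TensorProduct.equivFinsuppOfBasisLeft (Module.Basis.ofVectorSpace k V)).injective
  ext i
  rw [TensorProduct.equivFinsuppOfBasisLeft_apply, h1]
  simpa using h _

theorem mem_range_rTensor {M : Type*} [AddCommGroup M] [Module k M] (S : Submodule k M)
    (z : M ⊗[k] V) (h : ∀ f : V →ₗ[k] k, TensorProduct.rid k M (f.lTensor M z) ∈ S) :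
    z ∈ LinearMap.range (S.subtype.rTensor V) := by
  have h2 : ∀ (f : V →ₗ[k] k) (z : M ⊗[k] V),
      TensorProduct.lid k M (f.rTensor M (TensorProduct.comm k M V z))
        = TensorProduct.rid k M (f.lTensor M z) := by
    intro f z
    induction z using TensorProduct.induction_on with
    | zero => simp
    | tmul x y => simp
    | add a b ha hb => simp only [map_add, ha, hb]
  obtain ⟨y, hy⟩ := mem_range_lTensor S (TensorProduct.comm k M V z)
    (fun f => by rw [h2]; exact h f)
  refine ⟨(TensorProduct.comm k S V).symm y, (TensorProduct.comm k M V).injective ?_⟩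
  rw [← hy]
  generalize y = y
  induction y using TensorProduct.induction_on with
  | zero => simp
  | tmul x y => simp
  | add a b ha hb => simp only [map_add, ha, hb]

theorem contract_left (f : V →ₗ[k] k)
    (S : Submodule k (TensorAlgebra k V)) :
    letters k V * S ≤ S.comap ((TensorProduct.lid k _).toLinearMap ∘ₗ f.rTensor _ ∘ₗ splitL) := by
  rw [Submodule.mul_le]
  rintro _ ⟨v, rfl⟩ s hs
  simpa [splitL_ι_mul] using S.smul_mem (f v) hs

theorem contract_right (f : V →ₗ[k] k)
    (S : Submodule k (TensorAlgebra k V)) :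
    S * letters k V ≤ S.comap ((TensorProduct.rid k _).toLinearMap ∘ₗ f.lTensor _ ∘ₗ splitR) := by
  rw [Submodule.mul_le]
  rintro s hs _ ⟨v, rfl⟩
  simpa [splitR_mul_ι] using S.smul_mem (f v) hs

theorem splitL_mem (R : Submodule k (V ⊗[k] V)) (p : ℕ) (w : W R (p + 1)) :
    splitL (w : TensorAlgebra k V) ∈ LinearMap.range ((W R p).subtype.lTensor V) := by
  refine mem_range_lTensor _ _ fun f => ?_
  obtain ⟨w, hw⟩ := w
  match p with
  | 0 =>
    refine contract_left f 1 ?_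
    rw [mul_one]
    exact hw
  | 1 =>
    refine contract_left f (letters k V) ?_
    refine relations_le R ?_
    simpa using W_le_left R 0 hw
  | p + 2 =>
    simp only [W, Submodule.mem_iInf]
    intro i j h
    refine contract_left f (letters k V ^ i * relations R * letters k V ^ j) ?_
    rw [← mul_assoc, ← mul_assoc, ← pow_succ']
    exact W_le R (by omega) hw

theorem splitR_mem (R : Submodule k (V ⊗[k] V)) (p : ℕ) (w : W R (p + 1)) :
    splitR (w : TensorAlgebra k V) ∈ LinearMap.range ((W R p).subtype.rTensor V) := by
  refine mem_range_rTensor _ _ fun f => ?_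
  obtain ⟨w, hw⟩ := w
  match p with
  | 0 =>
    refine contract_right f 1 ?_
    rw [one_mul]
    exact hw
  | 1 =>
    refine contract_right f (letters k V) ?_
    refine relations_le R ?_
    simpa using W_le_left R 0 hw
  | p + 2 =>
    simp only [W, Submodule.mem_iInf]
    intro i j h
    refine contract_right f (letters k V ^ i * relations R * letters k V ^ j) ?_
    rw [mul_assoc, ← pow_succ]
    exact W_le R (by omega) hw

theorem inclL_injective (R : Submodule k (V ⊗[k] V)) (p : ℕ) (M : Type*) [AddCommGroup M]
    [Module k M] : Function.Injective ((W R p).subtype.lTensor M) :=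
  Module.Flat.lTensor_preserves_injective_linearMap _ (Submodule.injective_subtype _)

theorem inclR_injective (R : Submodule k (V ⊗[k] V)) (p : ℕ) (M : Type*) [AddCommGroup M]
    [Module k M] : Function.Injective ((W R p).subtype.rTensor M) :=
  Module.Flat.rTensor_preserves_injective_linearMap _ (Submodule.injective_subtype _)

/-- The inclusion `W_{p+1} ⊆ V ⊗ W_p`, `x₁ ⋯ xₚ₊₁ ↦ x₁ ⊗ x₂ ⋯ xₚ₊₁`. -/
def firstLetter (R : Submodule k (V ⊗[k] V)) (p : ℕ) : W R (p + 1) →ₗ[k] V ⊗[k] W R p :=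
  (LinearEquiv.ofInjective _ (inclL_injective R p V)).symm.toLinearMap ∘ₗ
    (splitL ∘ₗ (W R (p + 1)).subtype).codRestrict _ (splitL_mem R p)

/-- The inclusion `W_{p+1} ⊆ W_p ⊗ V`, `x₁ ⋯ xₚ₊₁ ↦ x₁ ⋯ xₚ ⊗ xₚ₊₁`. -/
def lastLetter (R : Submodule k (V ⊗[k] V)) (p : ℕ) : W R (p + 1) →ₗ[k] W R p ⊗[k] V :=
  (LinearEquiv.ofInjective _ (inclR_injective R p V)).symm.toLinearMap ∘ₗ
    (splitR ∘ₗ (W R (p + 1)).subtype).codRestrict _ (splitR_mem R p)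

theorem firstLetter_spec (R : Submodule k (V ⊗[k] V)) (p : ℕ) (w : W R (p + 1)) :
    (W R p).subtype.lTensor V (firstLetter R p w) = splitL (w : TensorAlgebra k V) := by
  have h := LinearEquiv.apply_symm_apply (LinearEquiv.ofInjective _ (inclL_injective R p V))
    ((splitL ∘ₗ (W R (p + 1)).subtype).codRestrict _ (splitL_mem R p) w)
  exact congrArg Subtype.val h

theorem lastLetter_spec (R : Submodule k (V ⊗[k] V)) (p : ℕ) (w : W R (p + 1)) :
    (W R p).subtype.rTensor V (lastLetter R p w) = splitR (w : TensorAlgebra k V) := by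
  have h := LinearEquiv.apply_symm_apply (LinearEquiv.ofInjective _ (inclR_injective R p V))
    ((splitR ∘ₗ (W R (p + 1)).subtype).codRestrict _ (splitR_mem R p) w)
  exact congrArg Subtype.val h

/-! ### The actions of the first and last letters -/

/-- `a ⊗ (x ⊗ t) ↦ (a f(x)) ⊗ t`. -/
def moveL (R : Submodule k (V ⊗[k] V)) (f : V →ₗ[k] QAlg R) (M : Type*) [AddCommGroup M]
    [Module k M] : QAlg R ⊗[k] (V ⊗[k] M) →ₗ[k] QAlg R ⊗[k] M :=
  (LinearMap.mul' k (QAlg R) ∘ₗ f.lTensor (QAlg R)).rTensor M ∘ₗ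
    (TensorProduct.assoc k (QAlg R) V M).symm.toLinearMap

/-- `(t ⊗ x) ⊗ a ↦ t ⊗ (f(x) a)`. -/
def moveR (R : Submodule k (V ⊗[k] V)) (f : V →ₗ[k] QAlg R) (M : Type*) [AddCommGroup M]
    [Module k M] : (M ⊗[k] V) ⊗[k] QAlg R →ₗ[k] M ⊗[k] QAlg R :=
  (LinearMap.mul' k (QAlg R) ∘ₗ f.rTensor (QAlg R)).lTensor M ∘ₗ
    (TensorProduct.assoc k M V (QAlg R)).toLinearMap

/-- `a ⊗ x₁ ⋯ xₚ₊₁ ↦ a f(x₁) ⊗ x₂ ⋯ xₚ₊₁`. -/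
def actL (R : Submodule k (V ⊗[k] V)) (f : V →ₗ[k] QAlg R) (p : ℕ) :
    QAlg R ⊗[k] W R (p + 1) →ₗ[k] QAlg R ⊗[k] W R p :=
  moveL R f (W R p) ∘ₗ (firstLetter R p).lTensor (QAlg R)

/-- `x₁ ⋯ xₚ₊₁ ⊗ a ↦ x₁ ⋯ xₚ ⊗ f(xₚ₊₁) a`. -/
def actR (R : Submodule k (V ⊗[k] V)) (f : V →ₗ[k] QAlg R) (p : ℕ) :
    W R (p + 1) ⊗[k] QAlg R →ₗ[k] W R p ⊗[k] QAlg R :=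
  moveR R f (W R p) ∘ₗ (lastLetter R p).rTensor (QAlg R)

/-- `a ⊗ x₁ ⋯ xₚ₊₁ ↦ f(xₚ₊₁) a ⊗ x₁ ⋯ xₚ`. -/
def actCyc (R : Submodule k (V ⊗[k] V)) (f : V →ₗ[k] QAlg R) (p : ℕ) :
    QAlg R ⊗[k] W R (p + 1) →ₗ[k] QAlg R ⊗[k] W R p :=
  (TensorProduct.comm k (W R p) (QAlg R)).toLinearMap ∘ₗ actR R f p ∘ₗ
    (TensorProduct.comm k (QAlg R) (W R (p + 1))).toLinearMap

/-! ### The bimodule Koszul complex, Koszul algebras -/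

/-- `K(A)_p = A ⊗ W_p ⊗ A`. -/
abbrev KBim (R : Submodule k (V ⊗[k] V)) (p : ℕ) : Type _ :=
  (QAlg R ⊗[k] W R p) ⊗[k] QAlg R

/-- The differential of `K(A)`, from degree `p + 1` to degree `p`:
`d(a ⊗ x₁ ⋯ xₚ₊₁ ⊗ a') = a x₁ ⊗ x₂ ⋯ xₚ₊₁ ⊗ a' + (-1)^{p+1} a ⊗ x₁ ⋯ xₚ ⊗ xₚ₊₁ a'`. -/
def dKBim (R : Submodule k (V ⊗[k] V)) (p : ℕ) : KBim R (p + 1) →ₗ[k] KBim R p :=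
  (actL R (eA R) p).rTensor (QAlg R) + (-1 : k) ^ (p + 1) •
    ((TensorProduct.assoc k (QAlg R) (W R p) (QAlg R)).symm.toLinearMap ∘ₗ
      (actR R (eA R) p).lTensor (QAlg R) ∘ₗ
      (TensorProduct.assoc k (QAlg R) (W R (p + 1)) (QAlg R)).toLinearMap)

/-- The quadratic algebra `A = T(V)/(R)` is Koszul if the homology of `K(A)` is zero in every
positive degree. -/
def IsKoszul (R : Submodule k (V ⊗[k] V)) : Prop :=
  ∀ p : ℕ, 0 < p → Subsingleton (Homology (KBim R) (dKBim R) p)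

/-! ### Koszul homology with coefficients in `A` -/

/-- The Koszul chains `A ⊗ W_p` with coefficients in `A`. -/
abbrev Chains (R : Submodule k (V ⊗[k] V)) (p : ℕ) : Type _ :=
  QAlg R ⊗[k] W R p

/-- The Koszul differential on chains `A ⊗ W_•`, from degree `p + 1` to degree `p`:
`b(a ⊗ x₁ ⋯ xₚ₊₁) = a x₁ ⊗ x₂ ⋯ xₚ₊₁ + (-1)^{p+1} xₚ₊₁ a ⊗ x₁ ⋯ xₚ`. -/
def bK (R : Submodule k (V ⊗[k] V)) (p : ℕ) :
    Chains R (p + 1) →ₗ[k] Chains R p :=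
  actL R (eA R) p + (-1 : k) ^ (p + 1) • actCyc R (eA R) p

/-- The Koszul homology `HK_p(A)`. -/
abbrev HK (R : Submodule k (V ⊗[k] V)) (p : ℕ) : Type _ := Homology (Chains R) (bK R) p

/-- The left Koszul cap product of a `1`-cochain `f : V → A` with a chain of degree `q = p + 1`:
`f ⌢ (a ⊗ x₁ ⋯ x_q) = (-1)^{q-1} f(x_q) a ⊗ x₁ ⋯ x_{q-1}`. -/
def capL (R : Submodule k (V ⊗[k] V)) (f : V →ₗ[k] QAlg R) (p : ℕ) :
    Chains R (p + 1) →ₗ[k] Chains R p :=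
  (-1 : k) ^ p • actCyc R f p

section Lemmas

variable (R : Submodule k (V ⊗[k] V))

theorem moveL_tmul (f : V →ₗ[k] QAlg R) {M : Type*} [AddCommGroup M] [Module k M]
    (a : QAlg R) (x : V) (t : M) : moveL R f M (a ⊗ₜ (x ⊗ₜ t)) = (a * f x) ⊗ₜ t := by
  simp [moveL]

theorem moveR_tmul (f : V →ₗ[k] QAlg R) {M : Type*} [AddCommGroup M] [Module k M]
    (a : QAlg R) (x : V) (t : M) : moveR R f M ((t ⊗ₜ x) ⊗ₜ a) = t ⊗ₜ (f x * a) := by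
  simp [moveR]

theorem moveL_natural (f : V →ₗ[k] QAlg R) {M N : Type*} [AddCommGroup M] [Module k M]
    [AddCommGroup N] [Module k N] (g : M →ₗ[k] N) (a : QAlg R) (z : V ⊗[k] M) :
    moveL R f N (a ⊗ₜ g.lTensor V z) = g.lTensor (QAlg R) (moveL R f M (a ⊗ₜ z)) := by
  induction z using TensorProduct.induction_on with
  | zero => simp
  | tmul x y => simp [moveL_tmul]
  | add y z hy hz => simp only [map_add, TensorProduct.tmul_add, hy, hz]

theorem moveR_natural (f : V →ₗ[k] QAlg R) {M N : Type*} [AddCommGroup M] [Module k M]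
    [AddCommGroup N] [Module k N] (g : M →ₗ[k] N) (a : QAlg R) (z : M ⊗[k] V) :
    moveR R f N (g.rTensor V z ⊗ₜ a) = g.rTensor (QAlg R) (moveR R f M (z ⊗ₜ a)) := by
  induction z using TensorProduct.induction_on with
  | zero => simp
  | tmul x y => simp [moveR_tmul]
  | add y z hy hz => simp only [map_add, TensorProduct.add_tmul, hy, hz]

/-- The map `actL` on `A ⊗ T(V)`. -/
def bigL : QAlg R ⊗[k] TensorAlgebra k V →ₗ[k] QAlg R ⊗[k] TensorAlgebra k V :=
  moveL R (eA R) _ ∘ₗ splitL.lTensor (QAlg R)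

/-- The map `actR` on `T(V) ⊗ A`. -/
def bigR : TensorAlgebra k V ⊗[k] QAlg R →ₗ[k] TensorAlgebra k V ⊗[k] QAlg R :=
  moveR R (eA R) _ ∘ₗ splitR.rTensor (QAlg R)

theorem incl_actL (p : ℕ) (z : QAlg R ⊗[k] W R (p + 1)) :
    (W R p).subtype.lTensor _ (actL R (eA R) p z)
      = bigL R ((W R (p + 1)).subtype.lTensor _ z) := by
  induction z using TensorProduct.induction_on with
  | zero => simp
  | tmul a w => simp [actL, bigL, ← moveL_natural, firstLetter_spec]
  | add y z hy hz => simp only [map_add, hy, hz]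

theorem incl_actR (p : ℕ) (z : W R (p + 1) ⊗[k] QAlg R) :
    (W R p).subtype.rTensor _ (actR R (eA R) p z)
      = bigR R ((W R (p + 1)).subtype.rTensor _ z) := by
  induction z using TensorProduct.induction_on with
  | zero => simp
  | tmul w a => simp [actR, bigR, ← moveR_natural, lastLetter_spec]
  | add y z hy hz => simp only [map_add, hy, hz]

theorem bigL_bigL (a : QAlg R) (s : V ⊗[k] V) (t : TensorAlgebra k V) :
    bigL R (bigL R (a ⊗ₜ (mulTwo k V s * t))) = (a * QAlg.proj R (mulTwo k V s)) ⊗ₜ t := by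
  induction s using TensorProduct.induction_on with
  | zero => simp
  | tmul x y => simp [bigL, mulTwo, mul_assoc, splitL_ι_mul, moveL_tmul, eA]
  | add y z hy hz =>
    simp only [map_add, add_mul, mul_add, TensorProduct.tmul_add, TensorProduct.add_tmul, hy, hz]

theorem bigR_bigR (a : QAlg R) (s : V ⊗[k] V) (t : TensorAlgebra k V) :
    bigR R (bigR R ((t * mulTwo k V s) ⊗ₜ a)) = t ⊗ₜ (QAlg.proj R (mulTwo k V s) * a) := by
  induction s using TensorProduct.induction_on with
  | zero => simp
  | tmul x y => simp [bigR, mulTwo, ← mul_assoc, splitR_mul_ι, moveR_tmul, eA]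
  | add y z hy hz =>
    simp only [map_add, add_mul, mul_add, TensorProduct.tmul_add, TensorProduct.add_tmul, hy, hz]

theorem actL_actL (p : ℕ) (z : QAlg R ⊗[k] W R (p + 2)) :
    actL R (eA R) p (actL R (eA R) (p + 1) z) = 0 := by
  apply inclL_injective R p (QAlg R)
  rw [incl_actL, incl_actL, map_zero]
  induction z using TensorProduct.induction_on with
  | zero => simp
  | add y z hy hz => simp only [map_add, hy, hz, add_zero]
  | tmul a w =>
    have key : relations R * letters k V ^ p ≤ LinearMap.ker
        (bigL R ∘ₗ bigL R ∘ₗ TensorProduct.mk k (QAlg R) (TensorAlgebra k V) a) := by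
      rw [Submodule.mul_le]
      rintro _ ⟨s, hs, rfl⟩ t -
      simp [bigL_bigL, QAlg.proj_relations R (Submodule.mem_map_of_mem (f := mulTwo k V) hs)]
    exact key (W_le_left R p w.2)

theorem actR_actR (p : ℕ) (z : W R (p + 2) ⊗[k] QAlg R) :
    actR R (eA R) p (actR R (eA R) (p + 1) z) = 0 := by
  apply inclR_injective R p (QAlg R)
  rw [incl_actR, incl_actR, map_zero]
  induction z using TensorProduct.induction_on with
  | zero => simp
  | add y z hy hz => simp only [map_add, hy, hz, add_zero]
  | tmul w a =>
    have key : letters k V ^ p * relations R ≤ LinearMap.ker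
        (bigR R ∘ₗ bigR R ∘ₗ (TensorProduct.mk k (TensorAlgebra k V) (QAlg R)).flip a) := by
      rw [Submodule.mul_le]
      rintro t - _ ⟨s, hs, rfl⟩
      simp [bigR_bigR, QAlg.proj_relations R (Submodule.mem_map_of_mem (f := mulTwo k V) hs)]
    exact key (W_le_right R p w.2)

/-- Removing the first and the last letter commute. -/
theorem first_last (p : ℕ) (w : W R (p + 2)) :
    (firstLetter R p).rTensor V (lastLetter R (p + 1) w)
      = (TensorProduct.assoc k V (W R p) V).symm
          ((lastLetter R p).lTensor V (firstLetter R (p + 1) w)) := by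
  have hinj : Function.Injective (((W R p).subtype.lTensor V).rTensor V) :=
    Module.Flat.rTensor_preserves_injective_linearMap _ (inclL_injective R p V)
  apply hinj
  have h1 : ∀ z : W R (p + 1) ⊗[k] V,
      ((W R p).subtype.lTensor V).rTensor V ((firstLetter R p).rTensor V z)
        = splitL.rTensor V ((W R (p + 1)).subtype.rTensor V z) := by
    intro z
    induction z using TensorProduct.induction_on with
    | zero => simp
    | tmul x y => simp [firstLetter_spec]
    | add y z hy hz => simp only [map_add, hy, hz]
  have h0 : ∀ (x : V) (y : W R p ⊗[k] V),
      ((W R p).subtype.lTensor V).rTensor V ((TensorProduct.assoc k V (W R p) V).symm (x ⊗ₜ y))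
        = (TensorProduct.assoc k V _ V).symm (x ⊗ₜ (W R p).subtype.rTensor V y) := by
    intro x y
    induction y using TensorProduct.induction_on with
    | zero => simp
    | tmul s t => simp
    | add y z hy hz => simp only [map_add, TensorProduct.tmul_add, hy, hz]
  have h2 : ∀ z : V ⊗[k] W R (p + 1),
      ((W R p).subtype.lTensor V).rTensor V ((TensorProduct.assoc k V (W R p) V).symm
          ((lastLetter R p).lTensor V z))
        = (TensorProduct.assoc k V _ V).symm
            (splitR.lTensor V ((W R (p + 1)).subtype.lTensor V z)) := by
    intro z
    induction z using TensorProduct.induction_on with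
    | zero => simp
    | tmul x y => simp [h0, lastLetter_spec]
    | add y z hy hz => simp only [map_add, hy, hz]
  rw [h1, h2, lastLetter_spec, firstLetter_spec]
  have key : letters k V * (letters k V ^ p * letters k V) ≤ LinearMap.eqLocus
      (splitL.rTensor V ∘ₗ splitR)
      ((TensorProduct.assoc k V (TensorAlgebra k V) V).symm.toLinearMap ∘ₗ
        splitR.lTensor V ∘ₗ splitL) := by
    rw [Submodule.mul_le]
    rintro _ ⟨x, rfl⟩ m hm
    refine Submodule.mul_induction_on hm ?_ ?_
    · rintro t - _ ⟨y, rfl⟩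
      rw [LinearMap.mem_eqLocus]
      simp [splitL_ι_mul, splitR_mul_ι, ← mul_assoc]
      simp [mul_assoc, splitL_ι_mul, splitR_mul_ι]
    · intro a b ha hb
      rw [mul_add]
      exact add_mem ha hb
  exact key (W_le_ends R p w.2)

theorem actCyc_tmul (f : V →ₗ[k] QAlg R) (p : ℕ) (a : QAlg R) (w : W R (p + 1)) :
    actCyc R f p (a ⊗ₜ w)
      = TensorProduct.comm k _ _ (moveR R f (W R p) (lastLetter R p w ⊗ₜ a)) := by
  simp [actCyc, actR]

theorem actL_tmul (f : V →ₗ[k] QAlg R) (p : ℕ) (a : QAlg R) (w : W R (p + 1)) :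
    actL R f p (a ⊗ₜ w) = moveL R f (W R p) (a ⊗ₜ firstLetter R p w) := by
  simp [actL]

theorem actCyc_actCyc (p : ℕ) (z : QAlg R ⊗[k] W R (p + 2)) :
    actCyc R (eA R) p (actCyc R (eA R) (p + 1) z) = 0 := by
  simp [actCyc, actR_actR]

theorem actL_actCyc (p : ℕ) (z : QAlg R ⊗[k] W R (p + 2)) :
    actL R (eA R) p (actCyc R (eA R) (p + 1) z)
      = actCyc R (eA R) p (actL R (eA R) (p + 1) z) := by
  induction z using TensorProduct.induction_on with
  | zero => simp
  | add y z hy hz => simp only [map_add, hy, hz]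
  | tmul a w =>
    let Φ : (V ⊗[k] W R p) ⊗[k] V →ₗ[k] QAlg R ⊗[k] W R p :=
      (TensorProduct.comm k (W R p) (QAlg R)).toLinearMap ∘ₗ moveR R (eA R) (W R p) ∘ₗ
      (TensorProduct.comm k (QAlg R) (W R p ⊗[k] V)).toLinearMap ∘ₗ
      moveL R (eA R) (W R p ⊗[k] V) ∘ₗ TensorProduct.mk k (QAlg R) _ a ∘ₗ
      (TensorProduct.assoc k V (W R p) V).toLinearMap
    have h0 : ∀ (z : V ⊗[k] W R p) (y : V),
        moveL R (eA R) (W R p) ((eA R y * a) ⊗ₜ z) = Φ (z ⊗ₜ y) := by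
      intro z y
      induction z using TensorProduct.induction_on with
      | zero => simp
      | tmul x t => simp [Φ, moveL_tmul, moveR_tmul, mul_assoc]
      | add y z hy hz => simp only [map_add, TensorProduct.tmul_add, TensorProduct.add_tmul, hy, hz]
    have h1 : ∀ z : W R (p + 1) ⊗[k] V,
        actL R (eA R) p (TensorProduct.comm k _ _ (moveR R (eA R) _ (z ⊗ₜ a)))
          = Φ ((firstLetter R p).rTensor V z) := by
      intro z
      induction z using TensorProduct.induction_on with
      | zero => simp
      | tmul x y => simp [moveR_tmul, actL_tmul, h0]
      | add y z hy hz => simp only [map_add, TensorProduct.add_tmul, hy, hz]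
    have h2 : ∀ z : V ⊗[k] W R (p + 1),
        actCyc R (eA R) p (moveL R (eA R) _ (a ⊗ₜ z))
          = Φ ((TensorProduct.assoc k V (W R p) V).symm ((lastLetter R p).lTensor V z)) := by
      intro z
      induction z using TensorProduct.induction_on with
      | zero => simp
      | tmul x y => simp [Φ, moveL_tmul, actCyc_tmul]
      | add y z hy hz => simp only [map_add, TensorProduct.tmul_add, hy, hz]
    rw [actCyc_tmul, actL_tmul, h1, h2, first_last]

/-- `d ∘ d = 0` in the bimodule Koszul complex. -/
theorem dKBim_dKBim (p : ℕ) (z : KBim R (p + 2)) : dKBim R p (dKBim R (p + 1) z) = 0 := by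
  let r : ∀ p, KBim R (p + 1) →ₗ[k] KBim R p := fun p =>
    (TensorProduct.assoc k (QAlg R) (W R p) (QAlg R)).symm.toLinearMap ∘ₗ
      (actR R (eA R) p).lTensor (QAlg R) ∘ₗ
      (TensorProduct.assoc k (QAlg R) (W R (p + 1)) (QAlg R)).toLinearMap
  have hr : ∀ p a (w : W R (p + 1)) a', r p ((a ⊗ₜ w) ⊗ₜ a')
      = (TensorProduct.assoc k (QAlg R) (W R p) (QAlg R)).symm
          (a ⊗ₜ moveR R (eA R) _ (lastLetter R p w ⊗ₜ a')) := by
    intro p a w a'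
    simp [r, actR]
  have hll : (actL R (eA R) p).rTensor (QAlg R) ((actL R (eA R) (p + 1)).rTensor (QAlg R) z)
      = 0 := by
    induction z using TensorProduct.induction_on with
    | zero => simp
    | tmul x y => simp [actL_actL]
    | add y z hy hz => simp only [map_add, hy, hz, add_zero]
  have hrr : r p (r (p + 1) z) = 0 := by
    have : ∀ z : QAlg R ⊗[k] (W R (p + 2) ⊗[k] QAlg R),
        (actR R (eA R) p).lTensor (QAlg R) ((actR R (eA R) (p + 1)).lTensor (QAlg R) z) = 0 := by
      intro z
      induction z using TensorProduct.induction_on with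
      | zero => simp
      | tmul x y => simp [actR_actR]
      | add y z hy hz => simp only [map_add, hy, hz, add_zero]
    simp [r, this]
  have hlr : (actL R (eA R) p).rTensor (QAlg R) (r (p + 1) z)
      = r p ((actL R (eA R) (p + 1)).rTensor (QAlg R) z) := by
    clear hll hrr
    induction z using TensorProduct.induction_on with
    | zero => simp
    | add y z hy hz => simp only [map_add, hy, hz]
    | tmul x a' =>
      induction x using TensorProduct.induction_on with
      | zero => simp
      | add y z hy hz => simp only [map_add, TensorProduct.add_tmul, hy, hz]
      | tmul a w =>
        let Φ : (V ⊗[k] W R p) ⊗[k] V →ₗ[k] KBim R p :=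
          (TensorProduct.assoc k (QAlg R) (W R p) (QAlg R)).symm.toLinearMap ∘ₗ
          (moveR R (eA R) (W R p)).lTensor (QAlg R) ∘ₗ
          (TensorProduct.assoc k (QAlg R) (W R p ⊗[k] V) (QAlg R)).toLinearMap ∘ₗ
          (TensorProduct.mk k (QAlg R ⊗[k] (W R p ⊗[k] V)) (QAlg R)).flip a' ∘ₗ
          moveL R (eA R) (W R p ⊗[k] V) ∘ₗ TensorProduct.mk k (QAlg R) _ a ∘ₗ
          (TensorProduct.assoc k V (W R p) V).toLinearMap
        have h0 : ∀ (z : V ⊗[k] W R p) (y : V),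
            moveL R (eA R) (W R p) (a ⊗ₜ z) ⊗ₜ (eA R y * a') = Φ (z ⊗ₜ y) := by
          intro z y
          induction z using TensorProduct.induction_on with
          | zero => simp
          | tmul x t => simp [Φ, moveL_tmul, moveR_tmul]
          | add y z hy hz =>
            simp only [map_add, TensorProduct.tmul_add, TensorProduct.add_tmul, hy, hz]
        have h1 : ∀ z : W R (p + 1) ⊗[k] V,
            (actL R (eA R) p).rTensor (QAlg R)
              ((TensorProduct.assoc k (QAlg R) (W R (p + 1)) (QAlg R)).symm
                (a ⊗ₜ moveR R (eA R) _ (z ⊗ₜ a')))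
              = Φ ((firstLetter R p).rTensor V z) := by
          intro z
          induction z using TensorProduct.induction_on with
          | zero => simp
          | tmul x y => simp [moveR_tmul, actL_tmul, h0]
          | add y z hy hz =>
            simp only [map_add, TensorProduct.add_tmul, TensorProduct.tmul_add, hy, hz]
        have h2 : ∀ z : V ⊗[k] W R (p + 1),
            r p (moveL R (eA R) _ (a ⊗ₜ z) ⊗ₜ a')
              = Φ ((TensorProduct.assoc k V (W R p) V).symm
                  ((lastLetter R p).lTensor V z)) := by
          intro z
          induction z using TensorProduct.induction_on with
          | zero => simp
          | tmul x y => simp [Φ, moveL_tmul, hr]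
          | add y z hy hz =>
            simp only [map_add, TensorProduct.add_tmul, TensorProduct.tmul_add, hy, hz]
        rw [hr, LinearMap.rTensor_tmul, actL_tmul, h1, h2, first_last]
  have hd : ∀ p (z : KBim R (p + 1)), dKBim R p z
      = (actL R (eA R) p).rTensor (QAlg R) z + (-1 : k) ^ (p + 1) • r p z := fun _ _ => rfl
  rw [hd, hd]
  simp only [map_add, map_smul, hll, hrr, hlr, pow_succ]
  module

/-- `b ∘ b = 0` on Koszul chains. -/
theorem bK_bK (p : ℕ) (z : QAlg R ⊗[k] W R (p + 2)) : bK R p (bK R (p + 1) z) = 0 := by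
  simp only [bK, LinearMap.add_apply, LinearMap.smul_apply, map_add, map_smul, actL_actL,
    actCyc_actCyc, actL_actCyc, pow_succ]
  module

/-- The cap product with the cocycle `e_A` anticommutes with the Koszul differential. -/
theorem bK_capL (p : ℕ) (z : QAlg R ⊗[k] W R (p + 2)) :
    bK R p (capL R (eA R) (p + 1) z) = - capL R (eA R) p (bK R (p + 1) z) := by
  simp only [bK, capL, LinearMap.add_apply, LinearMap.smul_apply, map_add, map_smul,
    actCyc_actCyc, actL_actCyc, pow_succ]
  module

theorem capL_capL (p : ℕ) (z : QAlg R ⊗[k] W R (p + 2)) :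
    capL R (eA R) p (capL R (eA R) (p + 1) z) = 0 := by
  simp [capL, actCyc_actCyc]

theorem capL_mem_cycles (p : ℕ) (z : QAlg R ⊗[k] W R (p + 1)) (hz : z ∈ cycles (Chains R) (bK R) (p + 1)) :
    capL R (eA R) p z ∈ cycles (Chains R) (bK R) p := by
  match p with
  | 0 => trivial
  | p + 1 =>
    have hz' : bK R (p + 1) z = 0 := hz
    change bK R p _ = 0
    rw [bK_capL, hz', map_zero, neg_zero]

end Lemmas

/-! ### Higher Koszul homology with coefficients in `A` -/

/-- The map `e_A ⌢ -` on Koszul cycles. -/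
def capCycles (R : Submodule k (V ⊗[k] V)) (p : ℕ) :
    cycles (Chains R) (bK R) (p + 1) →ₗ[k] cycles (Chains R) (bK R) p :=
  (capL R (eA R) p).restrict (capL_mem_cycles R p)

theorem capCycles_boundaries (R : Submodule k (V ⊗[k] V)) (p : ℕ) :
    (boundaries (Chains R) (bK R) (p + 1)).submoduleOf (cycles (Chains R) (bK R) (p + 1)) ≤
      ((boundaries (Chains R) (bK R) p).submoduleOf (cycles (Chains R) (bK R) p)).comap (capCycles R p) := by
  rintro ⟨z, hz⟩ ⟨y, hy⟩
  refine ⟨-capL R (eA R) (p + 1) y, ?_⟩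
  have hy' : bK R (p + 1) y = z := hy
  change bK R p _ = capL R (eA R) p z
  rw [map_neg, bK_capL, hy', neg_neg]

/-- The differential `∂ = ē_A ⌢ -` on Koszul homology, `HK_{p+1}(A) → HK_p(A)`: the class of a
cycle `z` is sent to the class of `e_A ⌢ z`. -/
def partialCap (R : Submodule k (V ⊗[k] V)) (p : ℕ) : HK R (p + 1) →ₗ[k] HK R p :=
  Submodule.mapQ _ _ (capCycles R p) (capCycles_boundaries R p)

theorem partialCap_partialCap (R : Submodule k (V ⊗[k] V)) (p : ℕ) (z : HK R (p + 2)) :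
    partialCap R p (partialCap R (p + 1) z) = 0 := by
  obtain ⟨z, rfl⟩ := Submodule.mkQ_surjective _ z
  have h : capCycles R p (capCycles R (p + 1) z) = 0 := Subtype.ext (capL_capL R p z.1)
  change Submodule.Quotient.mk (capCycles R p (capCycles R (p + 1) z)) = _
  rw [h, Submodule.Quotient.mk_zero]

/-- The higher Koszul homology `HK^{hi}_p(A)`: the homology of `HK_•(A)` for `∂ = ē_A ⌢ -`. -/
abbrev HKhi (R : Submodule k (V ⊗[k] V)) (p : ℕ) : Type _ := Homology (HK R) (partialCap R) p

end Quadratic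

end

/-!
Write `D` for the Euler derivation of `A`, the derivation which is the identity on letters. The
operator `weight = D ⊗ 1 + p` on `A ⊗ W_p` multiplies a chain by its number of letters. The theorem
holds because `weight` is homotopic to a commutator of the cap product with `e_A` and an operator
`B` of degree one, as for Connes' operator and the cap product with a derivation on Hochschild
homology (Rinehart, Goodwillie). In characteristic zero `weight` is invertible in positive degree,
and this kills the higher homology.

The operator `B` is built on Koszul chains, without the bar complex. The two augmentations
`ε ⊗ 1, 1 ⊗ ε : K(A) ⊗_A K(A) → K(A)` (`augDiff` is their difference) agree in homology of degree
zero, and `K(A) ⊗_A K(A)` is free on the spaces `W_i ⊗ A ⊗ W_j` (`Gen`), so for Koszul `A` there is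
a bimodule homotopy `h` between them (`augHomotopy`, `post_augHomotopy_succ`). Such bimodule maps
are handled through their restrictions to the generators, on which the differential of
`K(A) ⊗_A K(A)` acts by precomposition (`pre`). Let `κ(a ⊗ w ⊗ b) = b a ⊗ w`, let
`κ'(a ⊗ w ⊗ b) = D(b) a ⊗ w`, and cut `w = u v` in all possible ways with `u ∈ W_i`, `v ∈ W_j`
(`cutW`). Then

* `B(a ⊗ w) = ∑ (-1)^{ij} κ(h(v ⊗ a ⊗ u))` is `connes`,
* `B'(a ⊗ w) = ∑ (-1)^{ij} (j κ + κ')(h(v ⊗ a ⊗ u))` is `connesHomotopy`.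

In `b B` the terms in which a letter leaves `v` on the left cancel against those in which it leaves
`u` on the right, as `κ` does not distinguish `x z` from `z x`; for `B'` this cancellation leaves a
cap product (`cycSum_pre`). The contributions of the two augmentations cancel in `B`; in `B'` they
give `-weight` (`cycSum_augDiff`). Hence `b B + B b = 0` (`bK_connes`) and
`b B' + B' b + [B, e_A ⌢ -] = -weight` up to signs (`weight_eq`). Both formulas are the expansion
to first order in `τ - 1` of `b_τ B_τ + B_τ b_τ = 1 - τ^weight` for coefficients in `A` twisted by
`x ↦ τ x`; this explains the factor `j`.

In degree zero no Koszul hypothesis is needed. The elements `c ⊗ 1 - 1 ⊗ c` of `K(A)_0` are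
boundaries for every quadratic algebra, and applying `κ` and `κ'` to a bounding chain shows that
`D(c)` is the cap product of `e_A` with a cycle, up to commutators (`euler_mem_capBoundaries`).
As `A = k ⊕ D(A)`, only `k` is left.
-/

open scoped TensorProduct

noncomputable section

namespace Quadratic

variable {k : Type*} [Field k] {V : Type*} [AddCommGroup V] [Module k V]

section

variable (R : Submodule k (V ⊗[k] V))

/-! ### The bimodule structure of `A ⊗ W_p ⊗ A` -/

/-- Left multiplication on `A ⊗ W_p ⊗ A`. -/
def lact (p : ℕ) : QAlg R →ₗ[k] KBim R p →ₗ[k] KBim R p :=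
  LinearMap.rTensorHom (QAlg R) ∘ₗ LinearMap.rTensorHom (W R p) ∘ₗ LinearMap.mul k (QAlg R)

/-- Right multiplication on `A ⊗ W_p ⊗ A`. -/
def ract (p : ℕ) : QAlg R →ₗ[k] KBim R p →ₗ[k] KBim R p :=
  LinearMap.lTensorHom (QAlg R ⊗[k] W R p) ∘ₗ (LinearMap.mul k (QAlg R)).flip

@[simp]
theorem lact_tmul (p : ℕ) (a α β : QAlg R) (w : W R p) :
    lact R p a ((α ⊗ₜ w) ⊗ₜ β) = ((a * α) ⊗ₜ w) ⊗ₜ β := rfl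

@[simp]
theorem ract_tmul (p : ℕ) (b β : QAlg R) (y : QAlg R ⊗[k] W R p) :
    ract R p b (y ⊗ₜ β) = y ⊗ₜ (β * b) := rfl

variable {R}

/-- Equality of linear maps on `A ⊗ M ⊗ A` from their values on pure tensors. -/
theorem KBim_ext {p : ℕ} {N : Type*} [AddCommMonoid N] [Module k N] {f g : KBim R p →ₗ[k] N}
    (h : ∀ α w β, f ((α ⊗ₜ w) ⊗ₜ β) = g ((α ⊗ₜ w) ⊗ₜ β)) : f = g :=
  TensorProduct.ext_threefold h

theorem lact_mul (p : ℕ) (a b : QAlg R) (z : KBim R p) :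
    lact R p (a * b) z = lact R p a (lact R p b z) := by
  have : lact R p (a * b) = lact R p a ∘ₗ lact R p b :=
    KBim_ext fun α w β => by simp [mul_assoc]
  exact LinearMap.congr_fun this z

theorem ract_mul (p : ℕ) (a b : QAlg R) (z : KBim R p) :
    ract R p (a * b) z = ract R p b (ract R p a z) := by
  have : ract R p (a * b) = ract R p b ∘ₗ ract R p a :=
    KBim_ext fun α w β => by simp [mul_assoc]
  exact LinearMap.congr_fun this z

theorem lact_ract (p : ℕ) (a b : QAlg R) (z : KBim R p) :
    lact R p a (ract R p b z) = ract R p b (lact R p a z) := by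
  have : lact R p a ∘ₗ ract R p b = ract R p b ∘ₗ lact R p a :=
    KBim_ext fun α w β => by simp
  exact LinearMap.congr_fun this z

theorem dKBim_tmul (p : ℕ) (a a' : QAlg R) (w : W R (p + 1)) :
    dKBim R p ((a ⊗ₜ w) ⊗ₜ a') = moveL R (eA R) _ (a ⊗ₜ firstLetter R p w) ⊗ₜ a' +
      (-1 : k) ^ (p + 1) • (TensorProduct.assoc k (QAlg R) (W R p) (QAlg R)).symm
        (a ⊗ₜ moveR R (eA R) _ (lastLetter R p w ⊗ₜ a')) := by
  simp [dKBim, actL_tmul, actR]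

theorem dKBim_lact (p : ℕ) (a : QAlg R) (z : KBim R (p + 1)) :
    dKBim R p (lact R (p + 1) a z) = lact R p a (dKBim R p z) := by
  have : dKBim R p ∘ₗ lact R (p + 1) a = lact R p a ∘ₗ dKBim R p := by
    refine KBim_ext fun α w β => ?_
    simp only [LinearMap.comp_apply, lact_tmul, dKBim_tmul, map_add, map_smul]
    congr 1
    · generalize firstLetter R p w = y
      induction y using TensorProduct.induction_on with
      | zero => simp
      | tmul x y => simp [moveL_tmul, mul_assoc]
      | add y z hy hz => simp only [map_add, TensorProduct.tmul_add, TensorProduct.add_tmul, hy, hz]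
    · generalize lastLetter R p w = y
      congr 1
      induction y using TensorProduct.induction_on with
      | zero => simp
      | tmul x y => simp [moveR_tmul]
      | add y z hy hz => simp only [map_add, TensorProduct.tmul_add, TensorProduct.add_tmul, hy, hz]
  exact LinearMap.congr_fun this z

theorem dKBim_ract (p : ℕ) (a : QAlg R) (z : KBim R (p + 1)) :
    dKBim R p (ract R (p + 1) a z) = ract R p a (dKBim R p z) := by
  have : dKBim R p ∘ₗ ract R (p + 1) a = ract R p a ∘ₗ dKBim R p := by
    refine KBim_ext fun α w β => ?_
    simp only [LinearMap.comp_apply, ract_tmul, dKBim_tmul, map_add, map_smul]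
    congr 2
    generalize lastLetter R p w = y
    induction y using TensorProduct.induction_on with
    | zero => simp
    | tmul x y => simp [moveR_tmul, mul_assoc]
    | add y z hy hz => simp only [map_add, TensorProduct.tmul_add, TensorProduct.add_tmul, hy, hz]
  exact LinearMap.congr_fun this z

/-! ### The generators of `K(A) ⊗_A K(A)` and the maps out of them -/

/-- The space `W_i ⊗ A ⊗ W_j` of generators of the free bimodule `K(A)_i ⊗_A K(A)_j`. -/
abbrev Gen (R : Submodule k (V ⊗[k] V)) (i j : ℕ) : Type _ := W R i ⊗[k] (QAlg R ⊗[k] W R j)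

variable (R)

/-- `w ⊗ a ⊗ w' ↦ x ⊗ (u ⊗ a ⊗ w')` where `w = x u` with a letter `x`. -/
def genFirst (i j : ℕ) : Gen R (i + 1) j →ₗ[k] V ⊗[k] Gen R i j :=
  (TensorProduct.assoc k V (W R i) (QAlg R ⊗[k] W R j)).toLinearMap ∘ₗ
    (firstLetter R i).rTensor _

/-- `w ⊗ a ⊗ w' ↦ (w ⊗ a ⊗ u) ⊗ y` where `w' = u y` with a letter `y`. -/
def genLast (i j : ℕ) : Gen R i (j + 1) →ₗ[k] Gen R i j ⊗[k] V :=
  (TensorProduct.assoc k (W R i) (QAlg R ⊗[k] W R j) V).symm.toLinearMap ∘ₗ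
    ((TensorProduct.assoc k (QAlg R) (W R j) V).symm.toLinearMap ∘ₗ
      (lastLetter R j).lTensor (QAlg R)).lTensor (W R i)

/-- `w ⊗ a ⊗ w' ↦ u ⊗ y a ⊗ w'` where `w = u y` with a letter `y`. -/
def genInR (i j : ℕ) : Gen R (i + 1) j →ₗ[k] Gen R i j :=
  (TensorProduct.assoc k (W R i) (QAlg R) (W R j)).toLinearMap ∘ₗ
    (actR R (eA R) i).rTensor (W R j) ∘ₗ
    (TensorProduct.assoc k (W R (i + 1)) (QAlg R) (W R j)).symm.toLinearMap

/-- `w ⊗ a ⊗ w' ↦ w ⊗ a x ⊗ u` where `w' = x u` with a letter `x`. -/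
def genInL (i j : ℕ) : Gen R i (j + 1) →ₗ[k] Gen R i j :=
  (actL R (eA R) j).lTensor (W R i)

variable {R}

/-- `x ⊗ m ↦ x · g(m)`. -/
def letterL {M : Type*} [AddCommMonoid M] [Module k M] {q : ℕ} (g : M →ₗ[k] KBim R q) :
    V ⊗[k] M →ₗ[k] KBim R q :=
  TensorProduct.lift ((lact R q ∘ₗ eA R).compl₂ g)

/-- `m ⊗ y ↦ g(m) · y`. -/
def letterR {M : Type*} [AddCommMonoid M] [Module k M] {q : ℕ} (g : M →ₗ[k] KBim R q) :
    M ⊗[k] V →ₗ[k] KBim R q :=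
  TensorProduct.lift ((ract R q ∘ₗ eA R).compl₂ g).flip

@[simp]
theorem letterL_tmul {M : Type*} [AddCommMonoid M] [Module k M] {q : ℕ} (g : M →ₗ[k] KBim R q)
    (x : V) (m : M) : letterL g (x ⊗ₜ m) = lact R q (eA R x) (g m) := rfl

@[simp]
theorem letterR_tmul {M : Type*} [AddCommMonoid M] [Module k M] {q : ℕ} (g : M →ₗ[k] KBim R q)
    (y : V) (m : M) : letterR g (m ⊗ₜ y) = ract R q (eA R y) (g m) := rfl

theorem letterL_comp {M M' : Type*} [AddCommMonoid M] [Module k M] [AddCommMonoid M'] [Module k M']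
    {q : ℕ} (g : M →ₗ[k] KBim R q) (f : M' →ₗ[k] M) :
    letterL (g ∘ₗ f) = letterL g ∘ₗ f.lTensor V := TensorProduct.ext' fun _ _ => by simp

theorem letterR_comp {M M' : Type*} [AddCommMonoid M] [Module k M] [AddCommMonoid M'] [Module k M']
    {q : ℕ} (g : M →ₗ[k] KBim R q) (f : M' →ₗ[k] M) :
    letterR (g ∘ₗ f) = letterR g ∘ₗ f.rTensor V := TensorProduct.ext' fun _ _ => by simp

/-- `w ⊗ a ⊗ w' ↦ x · g(u ⊗ a ⊗ w')` where `w = x u` with a letter `x`. -/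
def outL {i j q : ℕ} (g : Gen R i j →ₗ[k] KBim R q) : Gen R (i + 1) j →ₗ[k] KBim R q :=
  letterL g ∘ₗ genFirst R i j

/-- `w ⊗ a ⊗ w' ↦ g(w ⊗ a ⊗ u) · y` where `w' = u y` with a letter `y`. -/
def outR {i j q : ℕ} (g : Gen R i j →ₗ[k] KBim R q) : Gen R i (j + 1) →ₗ[k] KBim R q :=
  letterR g ∘ₗ genLast R i j

theorem Gen_ext {i j : ℕ} {N : Type*} [AddCommMonoid N] [Module k N] {f g : Gen R i j →ₗ[k] N}
    (h : ∀ w a w', f (w ⊗ₜ (a ⊗ₜ w')) = g (w ⊗ₜ (a ⊗ₜ w'))) : f = g := by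
  refine TensorProduct.ext' fun w y => ?_
  induction y using TensorProduct.induction_on with
  | zero => simp
  | tmul a w' => exact h w a w'
  | add y z hy hz => simp only [TensorProduct.tmul_add, map_add, hy, hz]

theorem genInL_tmul (i j : ℕ) (w : W R i) (y : QAlg R ⊗[k] W R (j + 1)) :
    genInL R i j (w ⊗ₜ y) = w ⊗ₜ actL R (eA R) j y := rfl

theorem genInR_tmul (i j : ℕ) (w : W R (i + 1)) (a : QAlg R) (w' : W R j) :
    genInR R i j (w ⊗ₜ (a ⊗ₜ w'))
      = TensorProduct.assoc k _ _ _ (actR R (eA R) i (w ⊗ₜ a) ⊗ₜ w') := rfl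

theorem genFirst_tmul (i j : ℕ) (w : W R (i + 1)) (y : QAlg R ⊗[k] W R j) :
    genFirst R i j (w ⊗ₜ y) = TensorProduct.assoc k _ _ _ (firstLetter R i w ⊗ₜ y) := rfl

theorem genLast_tmul (i j : ℕ) (w : W R i) (a : QAlg R) (w' : W R (j + 1)) :
    genLast R i j (w ⊗ₜ (a ⊗ₜ w')) = (TensorProduct.assoc k _ _ _).symm
      (w ⊗ₜ (TensorProduct.assoc k _ _ _).symm (a ⊗ₜ lastLetter R j w')) := rfl

theorem actR_tmul (f : V →ₗ[k] QAlg R) (p : ℕ) (a : QAlg R) (w : W R (p + 1)) :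
    actR R f p (w ⊗ₜ a) = moveR R f (W R p) (lastLetter R p w ⊗ₜ a) := rfl

theorem genInL_genInL (i j : ℕ) : genInL R i j ∘ₗ genInL R i (j + 1) = 0 :=
  Gen_ext fun w a w' => by simp [genInL_tmul, actL_actL]

theorem genInR_genInR (i j : ℕ) : genInR R i j ∘ₗ genInR R (i + 1) j = 0 := by
  have : ∀ (w' : W R j) (y : W R (i + 1) ⊗[k] QAlg R),
      genInR R i j (TensorProduct.assoc k _ _ _ (y ⊗ₜ w'))
        = TensorProduct.assoc k _ _ _ (actR R (eA R) i y ⊗ₜ w') := by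
    intro w' y
    induction y using TensorProduct.induction_on with
    | zero => simp
    | tmul a w' => rfl
    | add y z hy hz => simp only [TensorProduct.add_tmul, map_add, hy, hz]
  exact Gen_ext fun w a w' => by simp [genInR_tmul, this, actR_actR]

end

section

variable {R : Submodule k (V ⊗[k] V)}

theorem genInR_genInL (i j : ℕ) :
    genInR R i j ∘ₗ genInL R (i + 1) j = genInL R i j ∘ₗ genInR R i (j + 1) := by
  refine Gen_ext fun w a w' => ?_
  obtain ⟨S, hS⟩ := TensorProduct.exists_finset (firstLetter R j w')
  obtain ⟨T, hT⟩ := TensorProduct.exists_finset (lastLetter R i w)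
  simp only [LinearMap.comp_apply, genInL_tmul, genInR_tmul, actL_tmul, actR_tmul, hS, hT,
    map_sum, TensorProduct.tmul_sum, TensorProduct.sum_tmul, moveL_tmul, moveR_tmul,
    TensorProduct.assoc_tmul]
  rw [Finset.sum_comm]
  simp only [mul_assoc]

/-- The values of `outL g` in terms of the first letters of the left factor. -/
theorem outL_tmul {i j q : ℕ} (g : Gen R i j →ₗ[k] KBim R q) (w : W R (i + 1))
    (y : QAlg R ⊗[k] W R j) :
    outL g (w ⊗ₜ y) = letterL (g ∘ₗ (TensorProduct.mk k _ _).flip y) (firstLetter R i w) := by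
  simp only [outL, LinearMap.comp_apply, genFirst_tmul]
  generalize firstLetter R i w = ζ
  induction ζ using TensorProduct.induction_on with
  | zero => simp
  | tmul x u => simp
  | add y z hy hz => simp only [TensorProduct.add_tmul, map_add, hy, hz]

/-- The values of `outR g` in terms of the last letters of the right factor. -/
theorem outR_tmul {i j q : ℕ} (g : Gen R i j →ₗ[k] KBim R q) (w : W R i) (a : QAlg R)
    (w' : W R (j + 1)) :
    outR g (w ⊗ₜ (a ⊗ₜ w'))
      = letterR (g ∘ₗ TensorProduct.mk k _ _ w ∘ₗ TensorProduct.mk k _ _ a)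
          (lastLetter R j w') := by
  simp only [outR, LinearMap.comp_apply, genLast_tmul]
  generalize lastLetter R j w' = ζ
  induction ζ using TensorProduct.induction_on with
  | zero => simp
  | tmul x u => simp
  | add y z hy hz => simp only [TensorProduct.tmul_add, map_add, hy, hz]

theorem outL_genInL {i j q : ℕ} (g : Gen R i j →ₗ[k] KBim R q) :
    outL (g ∘ₗ genInL R i j) = outL g ∘ₗ genInL R (i + 1) j := by
  refine Gen_ext fun w a w' => ?_
  simp only [LinearMap.comp_apply, genInL_tmul, outL_tmul]
  rfl

theorem outR_genInR {i j q : ℕ} (g : Gen R i j →ₗ[k] KBim R q) :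
    outR (g ∘ₗ genInR R i j) = outR g ∘ₗ genInR R i (j + 1) := by
  refine Gen_ext fun w a w' => ?_
  obtain ⟨S, hS⟩ := TensorProduct.exists_finset (lastLetter R j w')
  obtain ⟨T, hT⟩ := TensorProduct.exists_finset (lastLetter R i w)
  simp only [LinearMap.comp_apply, genInR_tmul, actR_tmul, outR_tmul, hS, hT, letterR_tmul,
    map_sum, TensorProduct.sum_tmul, moveR_tmul, TensorProduct.assoc_tmul, TensorProduct.mk_apply]
  rw [Finset.sum_comm]

theorem outL_outR {i j q : ℕ} (g : Gen R i j →ₗ[k] KBim R q) :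
    outL (outR g) = outR (outL g) := by
  refine Gen_ext fun w a w' => ?_
  obtain ⟨S, hS⟩ := TensorProduct.exists_finset (lastLetter R j w')
  obtain ⟨T, hT⟩ := TensorProduct.exists_finset (firstLetter R i w)
  simp only [LinearMap.comp_apply, outR_tmul, outL_tmul, hS, hT, letterR_tmul, letterL_tmul,
    map_sum, TensorProduct.mk_apply, lact_ract, LinearMap.flip_apply]
  rw [Finset.sum_comm]

theorem outL_genInR {i j q : ℕ} (g : Gen R i j →ₗ[k] KBim R q) :
    outL (g ∘ₗ genInR R i j) = outL g ∘ₗ genInR R (i + 1) j := by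
  refine Gen_ext fun w a w' => ?_
  let Ψ : W R i ⊗[k] V →ₗ[k] KBim R q :=
    g ∘ₗ (TensorProduct.assoc k _ _ _).toLinearMap ∘ₗ (TensorProduct.mk k _ _).flip w' ∘ₗ
      moveR R (eA R) (W R i) ∘ₗ (TensorProduct.mk k _ _).flip a
  have h1 : (g ∘ₗ genInR R i j) ∘ₗ (TensorProduct.mk k _ _).flip (a ⊗ₜ w')
      = Ψ ∘ₗ lastLetter R i := by
    ext u
    simp [Ψ, genInR_tmul, actR_tmul]
  have h2 : ∀ ζ : W R (i + 1) ⊗[k] V,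
      outL g (TensorProduct.assoc k _ _ _ (moveR R (eA R) _ (ζ ⊗ₜ a) ⊗ₜ w'))
        = letterL Ψ (TensorProduct.assoc k _ _ _ ((firstLetter R i).rTensor V ζ)) := by
    intro ζ
    induction ζ using TensorProduct.induction_on with
    | zero => simp
    | add y z hy hz => simp only [TensorProduct.add_tmul, map_add, hy, hz]
    | tmul v y =>
      obtain ⟨T, hT⟩ := TensorProduct.exists_finset (firstLetter R i v)
      simp [moveR_tmul, outL_tmul, hT, Ψ, TensorProduct.sum_tmul]
  rw [outL_tmul, h1, letterL_comp, LinearMap.comp_apply, LinearMap.comp_apply, genInR_tmul,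
    actR_tmul, h2, first_last, LinearEquiv.apply_symm_apply]

theorem outR_genInL {i j q : ℕ} (g : Gen R i j →ₗ[k] KBim R q) :
    outR (g ∘ₗ genInL R i j) = outR g ∘ₗ genInL R i (j + 1) := by
  refine Gen_ext fun w a w' => ?_
  let Ψ : V ⊗[k] W R j →ₗ[k] KBim R q :=
    g ∘ₗ TensorProduct.mk k _ _ w ∘ₗ moveL R (eA R) (W R j) ∘ₗ TensorProduct.mk k _ _ a
  have h1 : (g ∘ₗ genInL R i j) ∘ₗ TensorProduct.mk k _ _ w ∘ₗ TensorProduct.mk k _ _ a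
      = Ψ ∘ₗ firstLetter R j := by
    ext u
    simp [Ψ, genInL_tmul, actL_tmul]
  have h2 : ∀ ζ : V ⊗[k] W R (j + 1),
      outR g (w ⊗ₜ moveL R (eA R) _ (a ⊗ₜ ζ))
        = letterR Ψ ((TensorProduct.assoc k _ _ _).symm ((lastLetter R j).lTensor V ζ)) := by
    intro ζ
    induction ζ using TensorProduct.induction_on with
    | zero => simp
    | add y z hy hz => simp only [TensorProduct.tmul_add, map_add, hy, hz]
    | tmul v y =>
      obtain ⟨T, hT⟩ := TensorProduct.exists_finset (lastLetter R j y)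
      simp [moveL_tmul, outR_tmul, hT, Ψ, TensorProduct.tmul_sum]
  rw [outR_tmul, h1, letterR_comp, LinearMap.comp_apply, LinearMap.comp_apply, genInL_tmul,
    actL_tmul, h2, first_last]

/-- Two successive letters multiplied into `A` on the left give zero because every element of
`W_{i+2}` starts with a relation. -/
theorem outL_outL {i j q : ℕ} (g : Gen R i j →ₗ[k] KBim R q) : outL (outL g) = 0 := by
  refine TensorProduct.ext' fun w y => ?_
  let θ : QAlg R ⊗[k] W R i →ₗ[k] KBim R q :=
    TensorProduct.lift ((lact R q).compl₂ (g ∘ₗ (TensorProduct.mk k _ _).flip y))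
  have h1 : ∀ (a : QAlg R) (u : W R (i + 1)),
      lact R q a (outL g (u ⊗ₜ y)) = θ (actL R (eA R) i (a ⊗ₜ u)) := by
    intro a u
    obtain ⟨T, hT⟩ := TensorProduct.exists_finset (firstLetter R i u)
    simp [outL_tmul, actL_tmul, hT, θ, TensorProduct.tmul_sum, moveL_tmul, lact_mul]
  have h2 : ∀ ζ : V ⊗[k] W R (i + 1),
      letterL (outL g ∘ₗ (TensorProduct.mk k _ _).flip y) ζ
        = θ (actL R (eA R) i (moveL R (eA R) _ (1 ⊗ₜ ζ))) := by
    intro ζ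
    induction ζ using TensorProduct.induction_on with
    | zero => simp
    | add y z hy hz => simp only [TensorProduct.tmul_add, map_add, hy, hz]
    | tmul v y => simp [h1, moveL_tmul]
  rw [outL_tmul, h2, ← actL_tmul, actL_actL, map_zero, LinearMap.zero_apply]

theorem outR_outR {i j q : ℕ} (g : Gen R i j →ₗ[k] KBim R q) : outR (outR g) = 0 := by
  refine Gen_ext fun w a w' => ?_
  let θ : W R j ⊗[k] QAlg R →ₗ[k] KBim R q :=
    TensorProduct.lift
      ((ract R q).compl₂ (g ∘ₗ TensorProduct.mk k _ _ w ∘ₗ TensorProduct.mk k _ _ a)).flip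
  have h1 : ∀ (b : QAlg R) (u : W R (j + 1)),
      ract R q b (outR g (w ⊗ₜ (a ⊗ₜ u))) = θ (actR R (eA R) j (u ⊗ₜ b)) := by
    intro b u
    obtain ⟨T, hT⟩ := TensorProduct.exists_finset (lastLetter R j u)
    simp [outR_tmul, actR_tmul, hT, θ, TensorProduct.sum_tmul, moveR_tmul, ract_mul]
  have h2 : ∀ ζ : W R (j + 1) ⊗[k] V,
      letterR (outR g ∘ₗ TensorProduct.mk k _ _ w ∘ₗ TensorProduct.mk k _ _ a) ζ
        = θ (actR R (eA R) j (moveR R (eA R) _ (ζ ⊗ₜ 1))) := by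
    intro ζ
    induction ζ using TensorProduct.induction_on with
    | zero => simp
    | add y z hy hz => simp only [TensorProduct.add_tmul, map_add, hy, hz]
    | tmul v y => simp [h1, moveR_tmul]
  rw [outR_tmul, h2, ← actR_tmul, actR_actR, map_zero, LinearMap.zero_apply]

/-! ### Families of maps on the generators -/

/-- The part of the differential of `K(A) ⊗_A K(A)` coming from the left factor, acting by
precomposition on families `g_{ij} : W_i ⊗ A ⊗ W_j → A ⊗ W_q ⊗ A`, which stand for the bimodule
maps extending them. -/
def preL {q : ℕ} (g : ∀ i j, Gen R i j →ₗ[k] KBim R q) : ∀ i j, Gen R i j →ₗ[k] KBim R q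
  | 0, _ => 0
  | i + 1, j => outL (g i j) + (-1 : k) ^ (i + 1) • (g i j ∘ₗ genInR R i j)

/-- The part of the differential of `K(A) ⊗_A K(A)` coming from the right factor, acting by
precomposition on families of maps. -/
def preR {q : ℕ} (g : ∀ i j, Gen R i j →ₗ[k] KBim R q) : ∀ i j, Gen R i j →ₗ[k] KBim R q
  | _, 0 => 0
  | i, j + 1 => (-1 : k) ^ i • (g i j ∘ₗ genInL R i j + (-1 : k) ^ (j + 1) • outR (g i j))

theorem letterL_add {M : Type*} [AddCommMonoid M] [Module k M] {q : ℕ} (f g : M →ₗ[k] KBim R q) :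
    letterL (f + g) = letterL f + letterL g := TensorProduct.ext' fun _ _ => by simp

theorem letterL_smul {M : Type*} [AddCommMonoid M] [Module k M] {q : ℕ} (c : k)
    (g : M →ₗ[k] KBim R q) :
    letterL (c • g) = c • letterL g := TensorProduct.ext' fun _ _ => by simp

theorem letterR_add {M : Type*} [AddCommMonoid M] [Module k M] {q : ℕ} (f g : M →ₗ[k] KBim R q) :
    letterR (f + g) = letterR f + letterR g := TensorProduct.ext' fun _ _ => by simp

theorem letterR_smul {M : Type*} [AddCommMonoid M] [Module k M] {q : ℕ} (c : k)
    (g : M →ₗ[k] KBim R q) :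
    letterR (c • g) = c • letterR g := TensorProduct.ext' fun _ _ => by simp

variable {i j q : ℕ}

theorem outL_add (f g : Gen R i j →ₗ[k] KBim R q) : outL (f + g) = outL f + outL g := by
  simp only [outL, letterL_add, LinearMap.add_comp]

theorem outL_smul (c : k) (g : Gen R i j →ₗ[k] KBim R q) : outL (c • g) = c • outL g := by
  simp only [outL, letterL_smul, LinearMap.smul_comp]

theorem outL_zero : outL (0 : Gen R i j →ₗ[k] KBim R q) = 0 := by
  simpa using outL_smul (0 : k) (0 : Gen R i j →ₗ[k] KBim R q)

theorem outR_add (f g : Gen R i j →ₗ[k] KBim R q) : outR (f + g) = outR f + outR g := by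
  simp only [outR, letterR_add, LinearMap.add_comp]

theorem outR_smul (c : k) (g : Gen R i j →ₗ[k] KBim R q) : outR (c • g) = c • outR g := by
  simp only [outR, letterR_smul, LinearMap.smul_comp]

theorem outR_zero : outR (0 : Gen R i j →ₗ[k] KBim R q) = 0 := by
  simpa using outR_smul (0 : k) (0 : Gen R i j →ₗ[k] KBim R q)

theorem preL_preL (g : ∀ i j, Gen R i j →ₗ[k] KBim R q) : preL (preL g) = 0 := by
  funext i j
  match i with
  | 0 => rfl
  | 1 => simp [preL, outL_zero]
  | i + 2 =>
    simp only [preL, outL_add, outL_smul, outL_outL, outL_genInR, LinearMap.add_comp,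
      LinearMap.smul_comp, LinearMap.comp_assoc, genInR_genInR, LinearMap.comp_zero, pow_succ,
      Pi.zero_apply]
    module

theorem preR_preR (g : ∀ i j, Gen R i j →ₗ[k] KBim R q) : preR (preR g) = 0 := by
  funext i j
  match j with
  | 0 => rfl
  | 1 => simp [preR, outR_zero]
  | j + 2 =>
    simp only [preR, outR_add, outR_smul, outR_outR, outR_genInL, LinearMap.add_comp,
      LinearMap.smul_comp, LinearMap.comp_assoc, genInL_genInL, LinearMap.comp_zero, pow_succ,
      Pi.zero_apply]
    module

theorem preL_preR_add_preR_preL (g : ∀ i j, Gen R i j →ₗ[k] KBim R q) :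
    preL (preR g) + preR (preL g) = 0 := by
  funext i j
  match i, j with
  | 0, 0 => simp [preL, preR]
  | 0, j + 1 => simp [preL, preR, outR_zero]
  | i + 1, 0 => simp [preL, preR, outL_zero]
  | i + 1, j + 1 =>
    simp only [preL, preR, outR_add, outR_smul, outL_outR, outR_genInR, outL_add, outL_smul,
      outL_genInL, LinearMap.add_comp, LinearMap.smul_comp, LinearMap.comp_assoc, genInR_genInL,
      pow_succ, Pi.add_apply, Pi.zero_apply]
    module

/-- Precomposition with the differential of `K(A) ⊗_A K(A)`. -/
def pre (g : ∀ i j, Gen R i j →ₗ[k] KBim R q) : ∀ i j, Gen R i j →ₗ[k] KBim R q :=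
  preL g + preR g

theorem preL_add (f g : ∀ i j, Gen R i j →ₗ[k] KBim R q) : preL (f + g) = preL f + preL g := by
  funext i j
  match i with
  | 0 => simp [preL]
  | i + 1 =>
    simp only [preL, Pi.add_apply, outL_add, LinearMap.add_comp]
    module

theorem preR_add (f g : ∀ i j, Gen R i j →ₗ[k] KBim R q) : preR (f + g) = preR f + preR g := by
  funext i j
  match j with
  | 0 => simp [preR]
  | j + 1 =>
    simp only [preR, Pi.add_apply, outR_add, LinearMap.add_comp]
    module

theorem preL_smul (c : k) (g : ∀ i j, Gen R i j →ₗ[k] KBim R q) :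
    preL (c • g) = c • preL g := by
  funext i j
  match i with
  | 0 => simp [preL]
  | i + 1 =>
    simp only [preL, Pi.smul_apply, outL_smul, LinearMap.smul_comp]
    module

theorem preR_smul (c : k) (g : ∀ i j, Gen R i j →ₗ[k] KBim R q) :
    preR (c • g) = c • preR g := by
  funext i j
  match j with
  | 0 => simp [preR]
  | j + 1 =>
    simp only [preR, Pi.smul_apply, outR_smul, LinearMap.smul_comp]
    module

theorem pre_add (f g : ∀ i j, Gen R i j →ₗ[k] KBim R q) : pre (f + g) = pre f + pre g := by
  simp only [pre, preL_add, preR_add]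
  exact add_add_add_comm _ _ _ _

theorem pre_smul (c : k) (g : ∀ i j, Gen R i j →ₗ[k] KBim R q) : pre (c • g) = c • pre g := by
  simp only [pre, preL_smul, preR_smul, smul_add]

theorem pre_pre (g : ∀ i j, Gen R i j →ₗ[k] KBim R q) : pre (pre g) = 0 := by
  simp only [pre, preL_add, preR_add, preL_preL, preR_preR, zero_add, add_zero]
  rw [add_comm]
  exact (add_comm _ _).trans (preL_preR_add_preR_preL g)

/-- Postcomposition with the differential of `K(A)`. -/
def post (g : ∀ i j, Gen R i j →ₗ[k] KBim R (q + 1)) : ∀ i j, Gen R i j →ₗ[k] KBim R q :=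
  fun i j => dKBim R q ∘ₗ g i j

theorem dKBim_outL (g : Gen R i j →ₗ[k] KBim R (q + 1)) :
    dKBim R q ∘ₗ outL g = outL (dKBim R q ∘ₗ g) := by
  have : dKBim R q ∘ₗ letterL g = letterL (dKBim R q ∘ₗ g) :=
    TensorProduct.ext' fun _ _ => by simp [dKBim_lact]
  rw [outL, outL, ← this, LinearMap.comp_assoc]

theorem dKBim_outR (g : Gen R i j →ₗ[k] KBim R (q + 1)) :
    dKBim R q ∘ₗ outR g = outR (dKBim R q ∘ₗ g) := by
  have : dKBim R q ∘ₗ letterR g = letterR (dKBim R q ∘ₗ g) :=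
    TensorProduct.ext' fun _ _ => by simp [dKBim_ract]
  rw [outR, outR, ← this, LinearMap.comp_assoc]

theorem post_pre (g : ∀ i j, Gen R i j →ₗ[k] KBim R (q + 1)) : post (pre g) = pre (post g) := by
  have hL : post (preL g) = preL (post g) := by
    funext i j
    match i with
    | 0 => simp [post, preL]
    | i + 1 =>
      simp only [post, preL, LinearMap.comp_add, LinearMap.comp_smul, dKBim_outL,
        LinearMap.comp_assoc]
  have hR : post (preR g) = preR (post g) := by
    funext i j
    match j with
    | 0 => simp [post, preR]
    | j + 1 =>
      simp only [post, preR, LinearMap.comp_add, LinearMap.comp_smul, dKBim_outR,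
        LinearMap.comp_assoc]
  rw [pre, pre, ← hL, ← hR]
  funext i j
  simp only [post, Pi.add_apply, LinearMap.comp_add]

end

section

variable (R : Submodule k (V ⊗[k] V))

/-! ### The two augmentations `K(A) ⊗_A K(A) → K(A)` -/

/-- The counit `W_p → k`: the scalar of an element of `W_0 = k`, and zero for `p > 0`. -/
def counit (p : ℕ) : W R p →ₗ[k] k :=
  (TensorAlgebra.algebraMapInv (R := k) (M := V)).toLinearMap ∘ₗ (W R p).subtype

/-- The unit of `W_0 = k`. -/
def unitW : W R 0 := ⟨1, Submodule.one_le.mp le_rfl⟩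

variable {R}

theorem algebraMapInv_letters_mul (S : Submodule k (TensorAlgebra k V)) {t : TensorAlgebra k V}
    (ht : t ∈ letters k V * S) : TensorAlgebra.algebraMapInv (R := k) t = 0 := by
  have : letters k V * S ≤
      LinearMap.ker (TensorAlgebra.algebraMapInv (R := k) (M := V)).toLinearMap := by
    rw [Submodule.mul_le]
    rintro _ ⟨v, rfl⟩ s -
    simp [TensorAlgebra.algebraMapInv]
  exact this ht

theorem counit_succ (p : ℕ) (w : W R (p + 1)) : counit R (p + 1) w = 0 := by
  match p with
  | 0 =>
    refine algebraMapInv_letters_mul 1 ?_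
    rw [mul_one]
    exact w.2
  | p + 1 => exact algebraMapInv_letters_mul _ (W_le_ends R p w.2)

@[simp]
theorem counit_unitW : counit R 0 (unitW R) = 1 := by
  simp [counit, unitW]

theorem eq_counit_smul_unitW (w : W R 0) : w = counit R 0 w • unitW R := by
  obtain ⟨w, hw⟩ := w
  obtain ⟨r, rfl⟩ := Submodule.mem_one.mp hw
  ext
  simp [counit, unitW, Algebra.algebraMap_eq_smul_one]

theorem firstLetter_ι (v : V) (w : W R 1) (hw : (w : TensorAlgebra k V) = TensorAlgebra.ι k v) :
    firstLetter R 0 w = v ⊗ₜ unitW R := by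
  apply inclL_injective R 0 V
  rw [firstLetter_spec, hw]
  simpa [unitW] using splitL_ι_mul v 1

theorem lastLetter_ι (v : V) (w : W R 1) (hw : (w : TensorAlgebra k V) = TensorAlgebra.ι k v) :
    lastLetter R 0 w = unitW R ⊗ₜ v := by
  apply inclR_injective R 0 V
  rw [lastLetter_spec, hw]
  simpa [unitW] using splitR_mul_ι 1 v

/-- In degree one the first letter is the last letter; in higher degree there remains a letter
which the counit kills. -/
theorem counit_first_last (p : ℕ) (w : W R (p + 1)) :
    TensorProduct.rid k V ((counit R p).lTensor V (firstLetter R p w)) +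
      (-1 : k) ^ (p + 1) • TensorProduct.lid k V ((counit R p).rTensor V (lastLetter R p w))
      = 0 := by
  match p with
  | 0 =>
    obtain ⟨v, hv⟩ := w.2
    rw [firstLetter_ι v w hv.symm, lastLetter_ι v w hv.symm]
    simp
  | p + 1 =>
    have : counit R (p + 1) = 0 := LinearMap.ext (counit_succ p)
    simp [this]

variable (R) in
/-- The identity of `W_p` if `i = p`, and zero otherwise. -/
def same (i p : ℕ) : W R i →ₗ[k] W R p :=
  if h : i = p then Submodule.inclusion (le_of_eq (congrArg (W R) h)) else 0

@[simp]
theorem same_self (p : ℕ) : same R p p = LinearMap.id := by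
  rw [same, dif_pos rfl]
  rfl

theorem same_of_ne {i p : ℕ} (h : i ≠ p) : same R i p = 0 := dif_neg h

variable (R) in
/-- The family of maps `w ⊗ a ⊗ w' ↦ ε(w) a ⊗ w' ⊗ 1 - ε(w') 1 ⊗ w ⊗ a` into degree `p`: the
difference of the augmentations of the left and of the right factor of `K(A) ⊗_A K(A)`. -/
def augDiff (p i j : ℕ) : Gen R i j →ₗ[k] KBim R p :=
  TensorProduct.lift ((counit R i).smulRight
      ((TensorProduct.mk k _ (QAlg R)).flip 1 ∘ₗ (same R j p).lTensor (QAlg R))) +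
    (-1 : k) • TensorProduct.lift
      ((TensorProduct.mk k _ (QAlg R) ∘ₗ TensorProduct.mk k _ _ 1 ∘ₗ same R i p).compl₂
        ((TensorProduct.rid k _).toLinearMap ∘ₗ (counit R j).lTensor (QAlg R)))

theorem augDiff_tmul (p i j : ℕ) (w : W R i) (a : QAlg R) (w' : W R j) :
    augDiff R p i j (w ⊗ₜ (a ⊗ₜ w')) = counit R i w • ((a ⊗ₜ same R j p w') ⊗ₜ 1) +
      (-1 : k) • counit R j w' • ((1 ⊗ₜ same R i p w) ⊗ₜ a) := by
  simp [augDiff]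

theorem dKBim_same_left (p i : ℕ) (w : W R (i + 1)) (a a' : QAlg R) :
    dKBim R p ((a ⊗ₜ same R (i + 1) (p + 1) w) ⊗ₜ a') =
      moveL R (eA R) _ (a ⊗ₜ (same R i p).lTensor V (firstLetter R i w)) ⊗ₜ a' +
      (-1 : k) ^ (i + 1) • (TensorProduct.assoc k (QAlg R) (W R p) (QAlg R)).symm
        (a ⊗ₜ moveR R (eA R) _ ((same R i p).rTensor V (lastLetter R i w) ⊗ₜ a')) := by
  by_cases h : i = p
  · subst h
    simp [dKBim_tmul]
  · simp [same_of_ne h, same_of_ne (R := R) (show i + 1 ≠ p + 1 by omega)]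

theorem preL_augDiff (p i j : ℕ) (w : W R (i + 1)) (a : QAlg R) (w' : W R j) :
    preL (augDiff R p) (i + 1) j (w ⊗ₜ (a ⊗ₜ w'))
      = (-1 : k) • counit R j w' • dKBim R p ((1 ⊗ₜ same R (i + 1) (p + 1) w) ⊗ₜ a) := by
  obtain ⟨Ξ, hΞ⟩ : ∃ Ξ : V →ₗ[k] KBim R p, ∀ x, Ξ x = ((eA R x * a) ⊗ₜ same R j p w') ⊗ₜ 1 :=
    ⟨(TensorProduct.mk k _ (QAlg R)).flip 1 ∘ₗ
      (TensorProduct.mk k (QAlg R) (W R p)).flip (same R j p w') ∘ₗ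
        (LinearMap.mul k (QAlg R)).flip a ∘ₗ eA R, fun _ => rfl⟩
  have h1 : ∀ ζ, letterL (augDiff R p i j ∘ₗ (TensorProduct.mk k _ _).flip (a ⊗ₜ w')) ζ
      = Ξ (TensorProduct.rid k V ((counit R i).lTensor V ζ)) +
        (-1 : k) • counit R j w' •
          moveL R (eA R) _ (1 ⊗ₜ (same R i p).lTensor V ζ) ⊗ₜ[k] a := by
    intro ζ
    induction ζ using TensorProduct.induction_on with
    | zero => simp
    | add y z hy hz =>
      simp only [TensorProduct.tmul_add, TensorProduct.add_tmul, map_add, hy, hz, smul_add]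
      abel
    | tmul x u => simp [augDiff_tmul, hΞ, ← TensorProduct.smul_tmul', moveL_tmul]
  have h2 : ∀ ζ, augDiff R p i j
        (TensorProduct.assoc k _ _ _ (moveR R (eA R) (W R i) (ζ ⊗ₜ a) ⊗ₜ w'))
      = Ξ (TensorProduct.lid k V ((counit R i).rTensor V ζ)) +
        (-1 : k) • counit R j w' • (TensorProduct.assoc k (QAlg R) (W R p) (QAlg R)).symm
          (1 ⊗ₜ moveR R (eA R) _ ((same R i p).rTensor V ζ ⊗ₜ a)) := by
    intro ζ
    induction ζ using TensorProduct.induction_on with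
    | zero => simp
    | add y z hy hz =>
      simp only [TensorProduct.tmul_add, TensorProduct.add_tmul, map_add, hy, hz, smul_add]
      abel
    | tmul x u => simp [augDiff_tmul, hΞ, ← TensorProduct.smul_tmul', moveR_tmul]
  have h3 := congrArg Ξ (counit_first_last i w)
  rw [map_add, map_smul, map_zero] at h3
  rw [preL, LinearMap.add_apply, outL_tmul, h1, LinearMap.smul_apply, LinearMap.comp_apply,
    genInR_tmul, actR_tmul, h2, dKBim_same_left]
  refine Eq.trans ?_ (zero_add _)
  rw [← h3]
  module

theorem preR_augDiff (p i j : ℕ) (w : W R i) (a : QAlg R) (w' : W R (j + 1)) :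
    preR (augDiff R p) i (j + 1) (w ⊗ₜ (a ⊗ₜ w'))
      = counit R i w • dKBim R p ((a ⊗ₜ same R (j + 1) (p + 1) w') ⊗ₜ 1) := by
  obtain ⟨Ξ, hΞ⟩ : ∃ Ξ : V →ₗ[k] KBim R p, ∀ y, Ξ y = (1 ⊗ₜ same R i p w) ⊗ₜ (a * eA R y) :=
    ⟨TensorProduct.mk k _ (QAlg R) (1 ⊗ₜ same R i p w) ∘ₗ
      LinearMap.mul k (QAlg R) a ∘ₗ eA R, fun _ => rfl⟩
  have h1 : ∀ ζ, letterR (augDiff R p i j ∘ₗ TensorProduct.mk k _ _ w ∘ₗ TensorProduct.mk k _ _ a) ζ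
      = (-1 : k) • Ξ (TensorProduct.lid k V ((counit R j).rTensor V ζ)) +
        counit R i w • (TensorProduct.assoc k (QAlg R) (W R p) (QAlg R)).symm
          (a ⊗ₜ moveR R (eA R) _ ((same R j p).rTensor V ζ ⊗ₜ 1)) := by
    intro ζ
    induction ζ using TensorProduct.induction_on with
    | zero => simp
    | add y z hy hz =>
      simp only [TensorProduct.tmul_add, TensorProduct.add_tmul, map_add, hy, hz, smul_add]
      abel
    | tmul x u =>
      simp [augDiff_tmul, hΞ, moveR_tmul]
      exact add_comm _ _
  have h2 : ∀ ζ, augDiff R p i j (w ⊗ₜ moveL R (eA R) (W R j) (a ⊗ₜ ζ))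
      = (-1 : k) • Ξ (TensorProduct.rid k V ((counit R j).lTensor V ζ)) +
        counit R i w • moveL R (eA R) _ (a ⊗ₜ (same R j p).lTensor V ζ) ⊗ₜ[k] 1 := by
    intro ζ
    induction ζ using TensorProduct.induction_on with
    | zero => simp
    | add y z hy hz =>
      simp only [TensorProduct.tmul_add, TensorProduct.add_tmul, map_add, hy, hz, smul_add]
      abel
    | tmul x u =>
      simp [augDiff_tmul, hΞ, moveL_tmul]
      exact add_comm _ _
  have h3 := congrArg Ξ (counit_first_last j w')
  rw [map_add, map_smul, map_zero] at h3
  -- the sign `(-1)^i` is invisible: the counit of `w` vanishes unless `i = 0`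
  have h4 : (-1 : k) ^ i * counit R i w = counit R i w := by
    match i with
    | 0 => simp
    | i + 1 => simp [counit_succ]
  conv_rhs => rw [← h4]
  rw [preR, LinearMap.smul_apply, LinearMap.add_apply, LinearMap.smul_apply, outR_tmul, h1,
    LinearMap.comp_apply, genInL_tmul, actL_tmul, h2, dKBim_same_left]
  refine Eq.trans ?_ (zero_add _)
  rw [← smul_zero (-(-1 : k) ^ i), ← h3]
  module

/-- The difference of the two augmentations is a morphism of complexes. -/
theorem post_augDiff (p : ℕ) : post (augDiff R (p + 1)) = pre (augDiff R p) := by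
  have h0 : ∀ i, same R 0 (i + 1) = 0 := fun i => same_of_ne (by omega)
  funext i j
  refine Gen_ext fun w a w' => ?_
  simp only [post, LinearMap.comp_apply, augDiff_tmul, pre, Pi.add_apply, LinearMap.add_apply,
    map_add, map_smul]
  match i, j with
  | 0, 0 => simp [h0, preL, preR]
  | 0, j + 1 => rw [preR_augDiff]; simp [h0, preL]
  | i + 1, 0 => rw [preL_augDiff]; simp [h0, preR]
  | i + 1, j + 1 => rw [preR_augDiff, preL_augDiff, add_comm]

end

section

variable {R : Submodule k (V ⊗[k] V)}

/-! ### Homotopy between the two augmentations -/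

/-- Elements of `A` are polynomials in the letters. -/
theorem QAlg.proj_surjective : Function.Surjective (QAlg.proj R) :=
  RingQuot.mkAlgHom_surjective _ _

theorem eA_apply (v : V) : eA R v = QAlg.proj R (TensorAlgebra.ι k v) := rfl

theorem dKBim_ι (v : V) (w : W R 1) (hw : (w : TensorAlgebra k V) = TensorAlgebra.ι k v) :
    dKBim R 0 ((1 ⊗ₜ w) ⊗ₜ 1)
      = (eA R v ⊗ₜ unitW R) ⊗ₜ 1 + (-1 : k) • ((1 ⊗ₜ unitW R) ⊗ₜ eA R v) := by
  rw [dKBim_tmul, firstLetter_ι v w hw, lastLetter_ι v w hw]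
  simp [moveL_tmul, moveR_tmul]

/-- The elements `a ⊗ 1 - 1 ⊗ a` of `K(A)_0` are boundaries, whether `A` is Koszul or not. -/
theorem exists_dKBim_eq (a : QAlg R) : ∃ η : KBim R 1,
    dKBim R 0 η = (a ⊗ₜ unitW R) ⊗ₜ 1 + (-1 : k) • ((1 ⊗ₜ unitW R) ⊗ₜ a) := by
  obtain ⟨t, rfl⟩ := QAlg.proj_surjective a
  induction t using TensorAlgebra.induction with
  | algebraMap r =>
    refine ⟨0, ?_⟩
    simp only [map_zero, Algebra.algebraMap_eq_smul_one, map_smul, map_one,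
      ← TensorProduct.smul_tmul', TensorProduct.tmul_smul]
    module
  | ι v =>
    exact ⟨(1 ⊗ₜ ⟨TensorAlgebra.ι k v, v, rfl⟩) ⊗ₜ 1, dKBim_ι v _ rfl⟩
  | mul a b ha hb =>
    obtain ⟨x, hx⟩ := ha
    obtain ⟨y, hy⟩ := hb
    refine ⟨lact R 1 (QAlg.proj R a) y + ract R 1 (QAlg.proj R b) x, ?_⟩
    simp only [map_add, dKBim_lact, dKBim_ract, hx, hy, map_smul, lact_tmul, ract_tmul, map_mul,
      mul_one, one_mul]
    module
  | add a b ha hb =>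
    obtain ⟨x, hx⟩ := ha
    obtain ⟨y, hy⟩ := hb
    refine ⟨x + y, ?_⟩
    simp only [map_add, hx, hy, TensorProduct.add_tmul, TensorProduct.tmul_add]
    module

/-- A linear map between vector spaces has a linear section over its range. -/
theorem exists_section {M N : Type*} [AddCommGroup M] [Module k M] [AddCommGroup N] [Module k N]
    (d : M →ₗ[k] N) : ∃ s : N →ₗ[k] M, ∀ x, d (s (d x)) = d x := by
  obtain ⟨s, hs⟩ := d.rangeRestrict.exists_rightInverse_of_surjective d.range_rangeRestrict
  obtain ⟨s', hs'⟩ := s.exists_extend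
  refine ⟨s', fun x => ?_⟩
  have h1 : s' (d x) = s (d.rangeRestrict x) := LinearMap.congr_fun hs' (d.rangeRestrict x)
  rw [h1]
  exact congrArg Subtype.val (LinearMap.congr_fun hs (d.rangeRestrict x))

variable (R) in
/-- A linear section, over the boundaries, of the differential of `K(A)`. -/
def dSection (p : ℕ) : KBim R p →ₗ[k] KBim R (p + 1) :=
  (exists_section (M := KBim R (p + 1)) (N := KBim R p) (dKBim R p)).choose

theorem dKBim_dSection (p : ℕ) (z : KBim R p) (hz : z ∈ LinearMap.range (dKBim R p)) :
    dKBim R p (dSection R p z) = z := by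
  obtain ⟨x, rfl⟩ := hz
  exact (exists_section (M := KBim R (p + 1)) (N := KBim R p) (dKBim R p)).choose_spec x

variable (R) in
/-- The homotopy `h` between the two augmentations `K(A) ⊗_A K(A) → K(A)`, given on generators.
The component `augHomotopy R p i j` is of interest for `i + j = p`. -/
def augHomotopy : ∀ p i j : ℕ, Gen R i j →ₗ[k] KBim R (p + 1)
  | 0 => fun i j => dSection R 0 ∘ₗ augDiff R 0 i j
  | p + 1 => fun i j => dSection R (p + 1) ∘ₗ
      (augDiff R (p + 1) i j + (-1 : k) • pre (augHomotopy p) i j)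

theorem augDiff_zero_mem_range (i j : ℕ) (y : Gen R i j) :
    augDiff R 0 i j y ∈ LinearMap.range (dKBim R 0) := by
  suffices LinearMap.range (augDiff R 0 i j) ≤ LinearMap.range (dKBim R 0) from this ⟨y, rfl⟩
  have key : ∀ w a w', augDiff R 0 i j (w ⊗ₜ (a ⊗ₜ w')) ∈ LinearMap.range (dKBim R 0) := by
    intro w a w'
    rw [augDiff_tmul]
    match i, j with
    | i + 1, j =>
      rw [counit_succ, same_of_ne (i := i + 1) (by omega)]
      simp
    | 0, j + 1 =>
      rw [counit_succ, same_of_ne (i := j + 1) (by omega)]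
      simp
    | 0, 0 =>
      obtain ⟨η, hη⟩ := exists_dKBim_eq (R := R) a
      refine ⟨(counit R 0 w * counit R 0 w') • η, ?_⟩
      rw [map_smul, hη, same_self]
      conv_rhs => rw [LinearMap.id_apply, LinearMap.id_apply, eq_counit_smul_unitW w,
        eq_counit_smul_unitW w']
      simp only [map_smul, TensorProduct.tmul_smul, ← TensorProduct.smul_tmul', counit_unitW,
        smul_eq_mul, mul_one]
      module
  rintro _ ⟨y, rfl⟩
  induction y using TensorProduct.induction_on with
  | zero => simp
  | add y z hy hz => rw [map_add]; exact add_mem hy hz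
  | tmul w y =>
    induction y using TensorProduct.induction_on with
    | zero => simp
    | add y z hy hz => rw [TensorProduct.tmul_add, map_add]; exact add_mem hy hz
    | tmul a w' => exact key w a w'

/-- The homology vanishes if and only if every cycle is a boundary. -/
theorem subsingleton_homology_iff (C : ℕ → Type*) [∀ p, AddCommGroup (C p)] [∀ p, Module k (C p)]
    (d : ∀ p, C (p + 1) →ₗ[k] C p) (p : ℕ) :
    Subsingleton (Homology C d p) ↔ cycles C d p ≤ boundaries C d p := by
  rw [Submodule.Quotient.subsingleton_iff, Submodule.submoduleOf_eq_top]

theorem IsKoszul.mem_range (hR : IsKoszul R) (p : ℕ) (z : KBim R (p + 1))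
    (hz : dKBim R p z = 0) : z ∈ LinearMap.range (dKBim R (p + 1)) :=
  (subsingleton_homology_iff (KBim R) (dKBim R) (p + 1)).mp (hR (p + 1) (Nat.succ_pos p)) hz

theorem post_augHomotopy_zero : post (augHomotopy R 0) = augDiff R 0 := by
  funext i j
  refine LinearMap.ext fun y => ?_
  exact dKBim_dSection 0 _ (augDiff_zero_mem_range i j y)

/-- For a Koszul algebra, `h` is a homotopy: `d h + h d = ε ⊗ 1 - 1 ⊗ ε`. -/
theorem post_augHomotopy_succ (hR : IsKoszul R) (p : ℕ) :
    post (augHomotopy R (p + 1)) = augDiff R (p + 1) + (-1 : k) • pre (augHomotopy R p) := by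
  have step : ∀ p, post (pre (augHomotopy R p)) = pre (augDiff R p) →
      post (augHomotopy R (p + 1)) = augDiff R (p + 1) + (-1 : k) • pre (augHomotopy R p) := by
    intro p hp
    funext i j
    refine LinearMap.ext fun y => dKBim_dSection (p + 1) _ (hR.mem_range p _ ?_)
    have h1 := LinearMap.congr_fun (congrFun (congrFun (post_augDiff (R := R) p) i) j) y
    have h2 := LinearMap.congr_fun (congrFun (congrFun hp i) j) y
    simp only [post, LinearMap.comp_apply] at h1 h2
    rw [LinearMap.add_apply, LinearMap.smul_apply, map_add, map_smul, h1, h2]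
    module
  induction p with
  | zero =>
    apply step
    rw [post_pre, post_augHomotopy_zero]
  | succ p ih =>
    apply step
    rw [post_pre, ih, pre_add, pre_smul, pre_pre, smul_zero, add_zero]

end

section

/-! ### Deconcatenation on the spaces `W_p` -/

variable (k V) in
/-- Cutting a word after its first `i` letters, `x₁ ⋯ xₚ ↦ x₁ ⋯ xᵢ ⊗ xᵢ₊₁ ⋯ xₚ`. -/
def cut : ℕ → TensorAlgebra k V →ₗ[k] TensorAlgebra k V ⊗[k] TensorAlgebra k V
  | 0 => TensorProduct.mk k _ _ 1
  | i + 1 => TensorProduct.lift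
      (((LinearMap.mul k (TensorAlgebra k V ⊗[k] TensorAlgebra k V)) ∘ₗ
        (TensorProduct.mk k _ _).flip 1 ∘ₗ TensorAlgebra.ι k).compl₂ (cut i)) ∘ₗ splitL

theorem cut_mul (i : ℕ) (u t : TensorAlgebra k V) (hu : u ∈ letters k V ^ i) :
    cut k V i (u * t) = u ⊗ₜ t := by
  induction i generalizing u t with
  | zero =>
    rw [pow_zero] at hu
    obtain ⟨r, rfl⟩ := Submodule.mem_one.mp hu
    simp [cut, Algebra.algebraMap_eq_smul_one, TensorProduct.smul_tmul]
  | succ i ih =>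
    rw [pow_succ'] at hu
    refine Submodule.mul_induction_on hu ?_ ?_
    · rintro _ ⟨v, rfl⟩ s hs
      rw [mul_assoc, cut, LinearMap.comp_apply, splitL_ι_mul, TensorProduct.lift.tmul,
        LinearMap.compl₂_apply, ih _ _ hs]
      simp
    · intro x y hx hy
      rw [add_mul, map_add, hx, hy, TensorProduct.add_tmul]

variable {R : Submodule k (V ⊗[k] V)}

theorem W_le_pow (p : ℕ) : W R p ≤ letters k V ^ p := by
  match p with
  | 0 => exact le_of_eq (pow_zero _).symm
  | 1 => exact le_of_eq (pow_one _).symm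
  | p + 2 =>
    refine (W_le_ends R p).trans (le_of_eq ?_)
    rw [← pow_succ, ← pow_succ']

theorem word_le_pow {i j p : ℕ} (h : i + 2 + j = p) :
    letters k V ^ i * relations R * letters k V ^ j ≤ letters k V ^ p := by
  calc letters k V ^ i * relations R * letters k V ^ j
      ≤ letters k V ^ i * (letters k V * letters k V) * letters k V ^ j :=
        mul_le_mul' (mul_le_mul' le_rfl (relations_le R)) le_rfl
    _ = letters k V ^ p := by
        rw [← h, pow_add, pow_add, pow_two]

/-- A membership criterion for `W_j` which does not distinguish the cases `j = 0`, `j = 1` and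
`j ≥ 2` of its definition. -/
theorem mem_W_of_forall {j : ℕ} {t : TensorAlgebra k V} (h0 : t ∈ letters k V ^ j)
    (h : ∀ a b, a + 2 + b = j → t ∈ letters k V ^ a * relations R * letters k V ^ b) :
    t ∈ W R j := by
  match j with
  | 0 => rw [pow_zero] at h0; exact h0
  | 1 => rw [pow_one] at h0; exact h0
  | j + 2 => simpa only [W, Submodule.mem_iInf] using h

theorem contract_cut_left {i j p : ℕ} (hp : i + j = p) {w : TensorAlgebra k V} (hw : w ∈ W R p)
    (f : TensorAlgebra k V →ₗ[k] k) :
    TensorProduct.lid k _ (f.rTensor _ (cut k V i w)) ∈ W R j := by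
  have key : ∀ S : Submodule k (TensorAlgebra k V), w ∈ letters k V ^ i * S →
      TensorProduct.lid k _ (f.rTensor _ (cut k V i w)) ∈ S := by
    intro S hS
    refine Submodule.mul_induction_on hS ?_ ?_
    · intro u hu s hs
      rw [cut_mul i u s hu]
      simpa using S.smul_mem (f u) hs
    · intro x y hx hy
      simpa only [map_add] using add_mem hx hy
  refine mem_W_of_forall (key _ ?_) fun a b hab => key _ ?_
  · rw [← pow_add, hp]
    exact W_le_pow p hw
  · rw [← mul_assoc, ← mul_assoc, ← pow_add]
    exact W_le R (by omega) hw

theorem contract_cut_right {i j p : ℕ} (hp : i + j = p) {w : TensorAlgebra k V} (hw : w ∈ W R p)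
    (f : TensorAlgebra k V →ₗ[k] k) :
    TensorProduct.rid k _ (f.lTensor _ (cut k V i w)) ∈ W R i := by
  have key : ∀ S : Submodule k (TensorAlgebra k V), S ≤ letters k V ^ i →
      w ∈ S * letters k V ^ j →
      TensorProduct.rid k _ (f.lTensor _ (cut k V i w)) ∈ S := by
    intro S hi hS
    refine Submodule.mul_induction_on hS ?_ ?_
    · intro u hu s hs
      rw [cut_mul i u s (hi hu)]
      simpa using S.smul_mem (f s) hu
    · intro x y hx hy
      simpa only [map_add] using add_mem hx hy
  refine mem_W_of_forall (key _ le_rfl ?_) fun a b hab => key _ (word_le_pow hab) ?_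
  · rw [← pow_add, hp]
    exact W_le_pow p hw
  · rw [mul_assoc, ← pow_add]
    exact W_le R (by omega) hw

theorem cut_mem_range {i j p : ℕ} (hp : i + j = p) {w : TensorAlgebra k V} (hw : w ∈ W R p) :
    cut k V i w ∈ LinearMap.range (TensorProduct.map (W R i).subtype (W R j).subtype) := by
  obtain ⟨z, hz⟩ := mem_range_lTensor (W R j) (cut k V i w) (contract_cut_left hp hw)
  have h : z ∈ LinearMap.range ((W R i).subtype.rTensor (W R j)) := by
    refine mem_range_rTensor _ _ fun f => ?_
    obtain ⟨g, rfl⟩ := f.exists_extend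
    have h1 := contract_cut_right hp hw g
    rw [← hz, ← LinearMap.comp_apply, ← LinearMap.lTensor_comp] at h1
    exact h1
  obtain ⟨y, rfl⟩ := h
  refine ⟨y, ?_⟩
  rw [← hz, ← LinearMap.comp_apply, LinearMap.lTensor_comp_rTensor]

variable (R) in
/-- A linear projection of `T(V)` onto `W_p`. -/
def retraction (p : ℕ) : TensorAlgebra k V →ₗ[k] W R p :=
  ((W R p).subtype.exists_leftInverse_of_injective (W R p).ker_subtype).choose

theorem retraction_comp (p : ℕ) : retraction R p ∘ₗ (W R p).subtype = LinearMap.id :=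
  ((W R p).subtype.exists_leftInverse_of_injective (W R p).ker_subtype).choose_spec

variable (R) in
/-- The component `W_p → W_i ⊗ W_j`, for `p = i + j`, of the coproduct of the coalgebra `W_•`:
the restriction of `cut`. Without the condition `p = i + j` the values have no meaning. -/
def cutW (p i j : ℕ) : W R p →ₗ[k] W R i ⊗[k] W R j :=
  TensorProduct.map (retraction R i) (retraction R j) ∘ₗ cut k V i ∘ₗ (W R p).subtype

theorem cutW_spec {i j p : ℕ} (hp : i + j = p) (w : W R p) :
    TensorProduct.map (W R i).subtype (W R j).subtype (cutW R p i j w)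
      = cut k V i (w : TensorAlgebra k V) := by
  obtain ⟨y, hy⟩ := cut_mem_range hp w.2
  have : cutW R p i j w = y := by
    rw [cutW, LinearMap.comp_apply, LinearMap.comp_apply, Submodule.subtype_apply, ← hy,
      ← LinearMap.comp_apply, ← TensorProduct.map_comp, retraction_comp, retraction_comp,
      TensorProduct.map_id, LinearMap.id_apply]
  rw [this, hy]

theorem map_subtype_injective (i j : ℕ) :
    Function.Injective (TensorProduct.map (W R i).subtype (W R j).subtype) :=
  TensorProduct.map_injective_of_flat_flat _ _ (Submodule.injective_subtype _)
    (Submodule.injective_subtype _)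

theorem coe_unitW : ((unitW R : W R 0) : TensorAlgebra k V) = 1 := rfl

theorem cutW_zero_left (p : ℕ) (w : W R p) : cutW R p 0 p w = unitW R ⊗ₜ w := by
  apply map_subtype_injective
  rw [cutW_spec (zero_add p)]
  simp [cut, coe_unitW]

theorem cutW_zero_right (p : ℕ) (w : W R p) : cutW R p p 0 w = w ⊗ₜ unitW R := by
  apply map_subtype_injective
  rw [cutW_spec (add_zero p), ← mul_one (w : TensorAlgebra k V), cut_mul _ _ _ (W_le_pow p w.2)]
  simp [coe_unitW]

/-- Moving the cut by one letter. -/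
theorem cutW_first_last {i j p : ℕ} (hp : i + j = p) (w : W R (p + 1)) :
    (firstLetter R j).lTensor (W R i) (cutW R (p + 1) i (j + 1) w)
      = TensorProduct.assoc k _ _ _
          ((lastLetter R i).rTensor (W R j) (cutW R (p + 1) (i + 1) j w)) := by
  have hinj : Function.Injective
      (TensorProduct.map (W R i).subtype ((W R j).subtype.lTensor V)) :=
    TensorProduct.map_injective_of_flat_flat _ _ (Submodule.injective_subtype _)
      (inclL_injective R j V)
  apply hinj
  have h1 : ∀ z, TensorProduct.map (W R i).subtype ((W R j).subtype.lTensor V)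
      ((firstLetter R j).lTensor (W R i) z)
        = splitL.lTensor _ (TensorProduct.map (W R i).subtype (W R (j + 1)).subtype z) := by
    intro z
    induction z using TensorProduct.induction_on with
    | zero => simp
    | tmul x y => simp [firstLetter_spec]
    | add y z hy hz => simp only [map_add, hy, hz]
  have h0 : ∀ (x : W R i ⊗[k] V) (y : W R j),
      TensorProduct.map (W R i).subtype ((W R j).subtype.lTensor V)
        (TensorProduct.assoc k _ _ _ (x ⊗ₜ y))
        = TensorProduct.assoc k _ _ _ ((W R i).subtype.rTensor V x ⊗ₜ (W R j).subtype y) := by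
    intro x y
    induction x using TensorProduct.induction_on with
    | zero => simp
    | tmul s t => simp
    | add y z hy hz => simp only [map_add, TensorProduct.add_tmul, hy, hz]
  have h2 : ∀ z, TensorProduct.map (W R i).subtype ((W R j).subtype.lTensor V)
      (TensorProduct.assoc k _ _ _ ((lastLetter R i).rTensor (W R j) z))
        = TensorProduct.assoc k _ _ _
            (splitR.rTensor _ (TensorProduct.map (W R (i + 1)).subtype (W R j).subtype z)) := by
    intro z
    induction z using TensorProduct.induction_on with
    | zero => simp
    | tmul x y => simp [h0, lastLetter_spec]
    | add y z hy hz => simp only [map_add, hy, hz]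
  rw [h1, h2, cutW_spec (by omega), cutW_spec (by omega)]
  have key : letters k V ^ i * (letters k V * letters k V ^ j) ≤ LinearMap.eqLocus
      (splitL.lTensor _ ∘ₗ cut k V i)
      ((TensorProduct.assoc k _ V _).toLinearMap ∘ₗ splitR.rTensor _ ∘ₗ cut k V (i + 1)) := by
    rw [Submodule.mul_le]
    intro u hu m hm
    refine Submodule.mul_induction_on hm ?_ ?_
    · rintro _ ⟨x, rfl⟩ v -
      have hux : u * TensorAlgebra.ι k x ∈ letters k V ^ (i + 1) := by
        rw [pow_succ]
        exact Submodule.mul_mem_mul hu ⟨x, rfl⟩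
      rw [LinearMap.mem_eqLocus, LinearMap.comp_apply, cut_mul _ _ _ hu, LinearMap.comp_apply,
        LinearMap.comp_apply, ← mul_assoc, cut_mul _ _ _ hux]
      simp [splitL_ι_mul, splitR_mul_ι]
    · intro a b ha hb
      rw [mul_add]
      exact add_mem ha hb
  refine key ?_
  rw [← pow_succ', ← pow_add, ← add_assoc, hp]
  exact W_le_pow (p + 1) w.2

/-- Removing the last letter commutes with cutting before it. -/
theorem cutW_last {i j p : ℕ} (hp : i + j = p) (w : W R (p + 1)) :
    (lastLetter R j).lTensor (W R i) (cutW R (p + 1) i (j + 1) w)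
      = TensorProduct.assoc k _ _ _ ((cutW R p i j).rTensor V (lastLetter R p w)) := by
  have hinj : Function.Injective
      (TensorProduct.map (W R i).subtype ((W R j).subtype.rTensor V)) :=
    TensorProduct.map_injective_of_flat_flat _ _ (Submodule.injective_subtype _)
      (inclR_injective R j V)
  apply hinj
  have h1 : ∀ z, TensorProduct.map (W R i).subtype ((W R j).subtype.rTensor V)
      ((lastLetter R j).lTensor (W R i) z)
        = splitR.lTensor _ (TensorProduct.map (W R i).subtype (W R (j + 1)).subtype z) := by
    intro z
    induction z using TensorProduct.induction_on with
    | zero => simp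
    | tmul x y => simp [lastLetter_spec]
    | add y z hy hz => simp only [map_add, hy, hz]
  have h0 : ∀ (x : W R i ⊗[k] W R j) (y : V),
      TensorProduct.map (W R i).subtype ((W R j).subtype.rTensor V)
        (TensorProduct.assoc k _ _ _ (x ⊗ₜ y))
        = TensorProduct.assoc k _ _ _
            (TensorProduct.map (W R i).subtype (W R j).subtype x ⊗ₜ y) := by
    intro x y
    induction x using TensorProduct.induction_on with
    | zero => simp
    | tmul s t => simp
    | add y z hy hz => simp only [map_add, TensorProduct.add_tmul, hy, hz]
  have h2 : ∀ z : W R p ⊗[k] V, TensorProduct.map (W R i).subtype ((W R j).subtype.rTensor V)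
      (TensorProduct.assoc k _ _ _ ((cutW R p i j).rTensor V z))
        = TensorProduct.assoc k _ _ _
            ((cut k V i).rTensor V ((W R p).subtype.rTensor V z)) := by
    intro z
    induction z using TensorProduct.induction_on with
    | zero => simp
    | tmul x y => simp [h0, cutW_spec hp]
    | add y z hy hz => simp only [map_add, hy, hz]
  rw [h1, h2, cutW_spec (by omega), lastLetter_spec]
  have key : letters k V ^ i * (letters k V ^ j * letters k V) ≤ LinearMap.eqLocus
      (splitR.lTensor _ ∘ₗ cut k V i)
      ((TensorProduct.assoc k _ _ V).toLinearMap ∘ₗ (cut k V i).rTensor V ∘ₗ splitR) := by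
    rw [Submodule.mul_le]
    intro u hu m hm
    refine Submodule.mul_induction_on hm ?_ ?_
    · rintro v - _ ⟨y, rfl⟩
      rw [LinearMap.mem_eqLocus, LinearMap.comp_apply, cut_mul _ _ _ hu, LinearMap.comp_apply,
        LinearMap.comp_apply, ← mul_assoc, splitR_mul_ι, LinearMap.rTensor_tmul,
        cut_mul _ _ _ hu]
      simp [splitR_mul_ι]
    · intro a b ha hb
      rw [mul_add]
      exact add_mem ha hb
  refine key ?_
  rw [← pow_succ, ← pow_add, ← add_assoc, hp]
  exact W_le_pow (p + 1) w.2

/-- Removing the first letter commutes with cutting after it. -/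
theorem cutW_first {i j p : ℕ} (hp : i + j = p) (w : W R (p + 1)) :
    (firstLetter R i).rTensor (W R j) (cutW R (p + 1) (i + 1) j w)
      = (TensorProduct.assoc k _ _ _).symm
          ((cutW R p i j).lTensor V (firstLetter R p w)) := by
  have hinj : Function.Injective
      (TensorProduct.map ((W R i).subtype.lTensor V) (W R j).subtype) :=
    TensorProduct.map_injective_of_flat_flat _ _ (inclL_injective R i V)
      (Submodule.injective_subtype _)
  apply hinj
  have h1 : ∀ z, TensorProduct.map ((W R i).subtype.lTensor V) (W R j).subtype
      ((firstLetter R i).rTensor (W R j) z)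
        = splitL.rTensor _ (TensorProduct.map (W R (i + 1)).subtype (W R j).subtype z) := by
    intro z
    induction z using TensorProduct.induction_on with
    | zero => simp
    | tmul x y => simp [firstLetter_spec]
    | add y z hy hz => simp only [map_add, hy, hz]
  have h0 : ∀ (x : V) (y : W R i ⊗[k] W R j),
      TensorProduct.map ((W R i).subtype.lTensor V) (W R j).subtype
        ((TensorProduct.assoc k _ _ _).symm (x ⊗ₜ y))
        = (TensorProduct.assoc k _ _ _).symm
            (x ⊗ₜ TensorProduct.map (W R i).subtype (W R j).subtype y) := by
    intro x y
    induction y using TensorProduct.induction_on with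
    | zero => simp
    | tmul s t => simp
    | add y z hy hz => simp only [map_add, TensorProduct.tmul_add, hy, hz]
  have h2 : ∀ z : V ⊗[k] W R p, TensorProduct.map ((W R i).subtype.lTensor V) (W R j).subtype
      ((TensorProduct.assoc k _ _ _).symm ((cutW R p i j).lTensor V z))
        = (TensorProduct.assoc k _ _ _).symm
            ((cut k V i).lTensor V ((W R p).subtype.lTensor V z)) := by
    intro z
    induction z using TensorProduct.induction_on with
    | zero => simp
    | tmul x y => simp [h0, cutW_spec hp]
    | add y z hy hz => simp only [map_add, hy, hz]
  rw [h1, h2, cutW_spec (by omega), firstLetter_spec]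
  have key : letters k V * (letters k V ^ i * letters k V ^ j) ≤ LinearMap.eqLocus
      (splitL.rTensor _ ∘ₗ cut k V (i + 1))
      ((TensorProduct.assoc k V _ _).symm.toLinearMap ∘ₗ (cut k V i).lTensor V ∘ₗ splitL) := by
    rw [Submodule.mul_le]
    rintro _ ⟨x, rfl⟩ m hm
    refine Submodule.mul_induction_on hm ?_ ?_
    · rintro u hu v -
      have hxu : TensorAlgebra.ι k x * u ∈ letters k V ^ (i + 1) := by
        rw [pow_succ']
        exact Submodule.mul_mem_mul ⟨x, rfl⟩ hu
      rw [LinearMap.mem_eqLocus, LinearMap.comp_apply, LinearMap.comp_apply, LinearMap.comp_apply,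
        splitL_ι_mul, LinearMap.lTensor_tmul, cut_mul _ _ _ hu, ← mul_assoc, cut_mul _ _ _ hxu]
      simp [splitL_ι_mul]
    · intro a b ha hb
      rw [mul_add]
      exact add_mem ha hb
  refine key ?_
  rw [← pow_add, ← pow_succ', hp]
  exact W_le_pow (p + 1) w.2

end

section

variable (R : Submodule k (V ⊗[k] V))

/-! ### The Euler derivation and the augmentation of `A` -/

/-- Algebra maps out of `A` from linear maps on `V` killing the relations. -/
def QAlg.lift {B : Type*} [Ring B] [Algebra k B] (f : V →ₗ[k] B)
    (hf : ∀ s ∈ R, LinearMap.mul' k B (TensorProduct.map f f s) = 0) : QAlg R →ₐ[k] B :=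
  RingQuot.liftAlgHom k ⟨TensorAlgebra.lift k f, by
    rintro _ _ ⟨⟨s, hs, rfl⟩, rfl⟩
    rw [map_zero, ← hf s hs]
    generalize s = s
    induction s using TensorProduct.induction_on with
    | zero => simp
    | tmul x y => simp [mulTwo]
    | add a b ha hb => simp only [map_add, ha, hb]⟩

variable {R}

theorem QAlg.lift_proj {B : Type*} [Ring B] [Algebra k B] (f : V →ₗ[k] B)
    (hf : ∀ s ∈ R, LinearMap.mul' k B (TensorProduct.map f f s) = 0) (t : TensorAlgebra k V) :
    QAlg.lift R f hf (QAlg.proj R t) = TensorAlgebra.lift k f t :=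
  RingQuot.liftAlgHom_mkAlgHom_apply _ _ _ _

/-- Relations hold among the images of the letters. -/
theorem mul_eA_relation {s : V ⊗[k] V} (hs : s ∈ R) :
    LinearMap.mul' k (QAlg R) (TensorProduct.map (eA R) (eA R) s) = 0 := by
  rw [← QAlg.proj_relations R (Submodule.mem_map_of_mem (f := mulTwo k V) hs)]
  clear hs
  induction s using TensorProduct.induction_on with
  | zero => simp
  | tmul x y => simp [mulTwo, eA]
  | add a b ha hb => simp only [map_add, ha, hb]

variable (R) in
/-- The algebra map `A → A[ε]` which is `x ↦ x + ε x` on letters; its `ε`-part is the Euler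
derivation. -/
def eulerHom : QAlg R →ₐ[k] TrivSqZeroExt (QAlg R) (QAlg R) :=
  QAlg.lift R ((TrivSqZeroExt.inlAlgHom k (QAlg R) (QAlg R)).toLinearMap ∘ₗ eA R +
      (TrivSqZeroExt.inrHom (QAlg R) (QAlg R)).restrictScalars k ∘ₗ eA R) <| by
    intro s hs
    have h : ∀ s : V ⊗[k] V, LinearMap.mul' k (TrivSqZeroExt (QAlg R) (QAlg R))
        (TensorProduct.map
          ((TrivSqZeroExt.inlAlgHom k (QAlg R) (QAlg R)).toLinearMap ∘ₗ eA R +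
            (TrivSqZeroExt.inrHom (QAlg R) (QAlg R)).restrictScalars k ∘ₗ eA R)
          ((TrivSqZeroExt.inlAlgHom k (QAlg R) (QAlg R)).toLinearMap ∘ₗ eA R +
            (TrivSqZeroExt.inrHom (QAlg R) (QAlg R)).restrictScalars k ∘ₗ eA R) s)
        = TrivSqZeroExt.inl (LinearMap.mul' k (QAlg R) (TensorProduct.map (eA R) (eA R) s)) +
          TrivSqZeroExt.inr
            (LinearMap.mul' k (QAlg R) (TensorProduct.map (eA R) (eA R) s) +
              LinearMap.mul' k (QAlg R) (TensorProduct.map (eA R) (eA R) s)) := by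
      intro s
      induction s using TensorProduct.induction_on with
      | zero => simp
      | tmul x y => ext <;> simp
      | add a b ha hb =>
        simp only [map_add, ha, hb, TrivSqZeroExt.inl_add, TrivSqZeroExt.inr_add]
        abel
    rw [h, mul_eA_relation hs]
    simp

theorem eulerHom_eA (x : V) :
    eulerHom R (eA R x) = TrivSqZeroExt.inl (eA R x) + TrivSqZeroExt.inr (eA R x) := by
  rw [eA_apply, eulerHom, QAlg.lift_proj, TensorAlgebra.lift_ι_apply]
  rfl

theorem fst_eulerHom (a : QAlg R) : (eulerHom R a).fst = a := by
  obtain ⟨t, rfl⟩ := QAlg.proj_surjective a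
  induction t using TensorAlgebra.induction with
  | algebraMap r => simp [TrivSqZeroExt.algebraMap_eq_inl']
  | ι v => simp [← eA_apply, eulerHom_eA]
  | mul a b ha hb => simp only [map_mul, TrivSqZeroExt.fst_mul, ha, hb]
  | add a b ha hb => simp only [map_add, TrivSqZeroExt.fst_add, ha, hb]

variable (R) in
/-- The Euler derivation of `A`: the derivation which is the identity on letters. -/
def euler : QAlg R →ₗ[k] QAlg R where
  toFun a := (eulerHom R a).snd
  map_add' a b := by simp
  map_smul' c a := by simp

theorem euler_eA (x : V) : euler R (eA R x) = eA R x := by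
  simp [euler, eulerHom_eA]

theorem euler_mul (a b : QAlg R) : euler R (a * b) = a * euler R b + euler R a * b := by
  simp [euler, fst_eulerHom]

@[simp]
theorem euler_one : euler R 1 = 0 := by
  simp [euler]

/-- A word of length `n` is an eigenvector of the Euler derivation with eigenvalue `n`. -/
theorem euler_proj {n : ℕ} {t : TensorAlgebra k V} (ht : t ∈ letters k V ^ n) :
    euler R (QAlg.proj R t) = (n : k) • QAlg.proj R t := by
  induction n generalizing t with
  | zero =>
    rw [pow_zero] at ht
    obtain ⟨r, rfl⟩ := Submodule.mem_one.mp ht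
    simp [Algebra.algebraMap_eq_smul_one]
  | succ n ih =>
    rw [pow_succ'] at ht
    refine Submodule.mul_induction_on ht ?_ ?_
    · rintro _ ⟨v, rfl⟩ s hs
      rw [map_mul, euler_mul, ih hs, ← eA_apply, euler_eA, mul_smul_comm]
      push_cast
      module
    · intro x y hx hy
      rw [map_add, map_add, hx, hy, smul_add]

/-- `A` is spanned by words. -/
theorem QAlg.word_induction {P : QAlg R → Prop}
    (word : ∀ n, ∀ t ∈ letters k V ^ n, P (QAlg.proj R t))
    (add : ∀ a b, P a → P b → P (a + b)) (a : QAlg R) : P a := by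
  obtain ⟨t, rfl⟩ := QAlg.proj_surjective a
  have ht : t ∈ ⨆ n, letters k V ^ n := by
    induction t using TensorAlgebra.induction with
    | algebraMap r =>
      refine Submodule.mem_iSup_of_mem 0 ?_
      rw [pow_zero]
      exact Submodule.mem_one.mpr ⟨r, rfl⟩
    | ι v =>
      refine Submodule.mem_iSup_of_mem 1 ?_
      rw [pow_one]
      exact ⟨v, rfl⟩
    | mul a b ha hb =>
      have h := Submodule.mul_mem_mul ha hb
      rw [Submodule.iSup_mul] at h
      refine (iSup_le fun i => ?_ : _ ≤ ⨆ n, letters k V ^ n) h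
      rw [Submodule.mul_iSup]
      refine iSup_le fun j => ?_
      rw [← pow_add]
      exact le_iSup (fun n => letters k V ^ n) (i + j)
    | add a b ha hb => exact add_mem ha hb
  refine Submodule.iSup_induction (fun n => letters k V ^ n)
    (motive := fun t => P (QAlg.proj R t)) ht word ?_ ?_
  · exact word 0 0 (zero_mem _)
  · intro x y hx hy
    rw [map_add]
    exact add _ _ hx hy

variable (R) in
/-- The augmentation `A → k`, killing the letters. -/
def aug : QAlg R →ₐ[k] k := QAlg.lift R 0 (by intro s hs; simp)

@[simp]
theorem aug_eA (x : V) : aug R (eA R x) = 0 := by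
  rw [eA_apply, aug, QAlg.lift_proj]
  simp

/-- `A` is spanned by `1` and by the image of the Euler derivation. -/
theorem exists_euler_eq [CharZero k] (a : QAlg R) :
    ∃ c, a = algebraMap k _ (aug R a) + euler R c := by
  induction a using QAlg.word_induction with
  | word n t ht =>
    match n with
    | 0 =>
      rw [pow_zero] at ht
      obtain ⟨r, rfl⟩ := Submodule.mem_one.mp ht
      exact ⟨0, by simp⟩
    | n + 1 =>
      refine ⟨((n + 1 : ℕ) : k)⁻¹ • QAlg.proj R t, ?_⟩
      have h0 : aug R (QAlg.proj R t) = 0 := by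
        rw [pow_succ'] at ht
        refine Submodule.mul_induction_on ht ?_ ?_
        · rintro _ ⟨v, rfl⟩ s -
          rw [map_mul, map_mul, ← eA_apply, aug_eA, zero_mul]
        · intro x y hx hy
          rw [map_add, map_add, hx, hy, add_zero]
      rw [h0, map_zero, zero_add, map_smul, euler_proj ht, smul_smul, inv_mul_cancel₀, one_smul]
      exact_mod_cast Nat.succ_ne_zero n
  | add a b ha hb =>
    obtain ⟨c, hc⟩ := ha
    obtain ⟨d, hd⟩ := hb
    refine ⟨c + d, ?_⟩
    conv_lhs => rw [hc, hd]
    simp only [map_add]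
    abel

/-! ### Contracting bimodule chains to cyclic chains -/

variable (R) in
/-- `a ⊗ w ⊗ b ↦ φ(b) a ⊗ w`. -/
def close (φ : QAlg R →ₗ[k] QAlg R) (p : ℕ) : KBim R p →ₗ[k] Chains R p :=
  TensorProduct.lift (LinearMap.rTensorHom (W R p) ∘ₗ LinearMap.mul k (QAlg R) ∘ₗ φ).flip

@[simp]
theorem close_tmul (φ : QAlg R →ₗ[k] QAlg R) (p : ℕ) (a b : QAlg R) (w : W R p) :
    close R φ p ((a ⊗ₜ w) ⊗ₜ b) = (φ b * a) ⊗ₜ w := rfl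

theorem close_dKBim_tmul (φ : QAlg R →ₗ[k] QAlg R) (p : ℕ) (a b : QAlg R) (w : W R (p + 1)) :
    close R φ p (dKBim R p ((a ⊗ₜ w) ⊗ₜ b)) = actL R (eA R) p ((φ b * a) ⊗ₜ w) +
      (-1 : k) ^ (p + 1) • TensorProduct.lift ((TensorProduct.mk k (QAlg R) (W R p)).flip.compl₂
        ((LinearMap.mul k (QAlg R)).flip a ∘ₗ φ ∘ₗ (LinearMap.mul k (QAlg R)).flip b ∘ₗ eA R))
          (lastLetter R p w) := by
  rw [dKBim_tmul, actL_tmul, map_add, map_smul]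
  congr 1
  · generalize firstLetter R p w = ζ
    induction ζ using TensorProduct.induction_on with
    | zero => simp
    | tmul x y => simp [moveL_tmul, mul_assoc]
    | add y z hy hz => simp only [map_add, TensorProduct.tmul_add, TensorProduct.add_tmul, hy, hz]
  · congr 1
    generalize lastLetter R p w = ζ
    induction ζ using TensorProduct.induction_on with
    | zero => simp
    | tmul x y => simp [moveR_tmul]
    | add y z hy hz => simp only [map_add, TensorProduct.tmul_add, TensorProduct.add_tmul, hy, hz]

theorem actCyc_tmul_eq_lift (p : ℕ) (a : QAlg R) (w : W R (p + 1)) :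
    actCyc R (eA R) p (a ⊗ₜ w) = TensorProduct.lift
      ((TensorProduct.mk k (QAlg R) (W R p)).flip.compl₂
        ((LinearMap.mul k (QAlg R)).flip a ∘ₗ eA R)) (lastLetter R p w) := by
  rw [actCyc_tmul]
  generalize lastLetter R p w = ζ
  induction ζ using TensorProduct.induction_on with
  | zero => simp
  | tmul x y => simp [moveR_tmul]
  | add y z hy hz => simp only [map_add, TensorProduct.add_tmul, hy, hz]

theorem close_id_dKBim (p : ℕ) (z : KBim R (p + 1)) :
    close R LinearMap.id p (dKBim R p z) = bK R p (close R LinearMap.id (p + 1) z) := by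
  have : close R LinearMap.id p ∘ₗ dKBim R p = bK R p ∘ₗ close R LinearMap.id (p + 1) := by
    refine KBim_ext fun a w b => ?_
    rw [LinearMap.comp_apply, close_dKBim_tmul, LinearMap.comp_apply, close_tmul, bK,
      LinearMap.add_apply, LinearMap.smul_apply, actCyc_tmul_eq_lift]
    congr 4
    ext x
    simp [mul_assoc]
  exact LinearMap.congr_fun this z

/-- The defect of `a ⊗ w ⊗ b ↦ D(b) a ⊗ w`, where `D` is the Euler derivation, from being a
morphism of complexes comes from `D(x) = x`; up to sign it is the cap product with `e_A`. -/
theorem close_euler_dKBim (p : ℕ) (z : KBim R (p + 1)) :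
    close R (euler R) p (dKBim R p z) = bK R p (close R (euler R) (p + 1) z) +
      (-1 : k) ^ (p + 1) • actCyc R (eA R) p (close R LinearMap.id (p + 1) z) := by
  have : close R (euler R) p ∘ₗ dKBim R p = bK R p ∘ₗ close R (euler R) (p + 1) +
      (-1 : k) ^ (p + 1) • actCyc R (eA R) p ∘ₗ close R LinearMap.id (p + 1) := by
    refine KBim_ext fun a w b => ?_
    rw [LinearMap.comp_apply, close_dKBim_tmul, LinearMap.add_apply, LinearMap.comp_apply,
      LinearMap.smul_apply, LinearMap.comp_apply, close_tmul, close_tmul, bK,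
      LinearMap.add_apply, LinearMap.smul_apply, actCyc_tmul_eq_lift, actCyc_tmul_eq_lift, add_assoc,
      ← smul_add, ← LinearMap.add_apply]
    congr 3
    refine TensorProduct.ext' fun u y => ?_
    simp [euler_mul, euler_eA, mul_assoc]
  exact LinearMap.congr_fun this z

end

section

variable (R : Submodule k (V ⊗[k] V))

/-! ### Cyclic rotation of Koszul chains -/

/-- `a ⊗ (u ⊗ v) ↦ v ⊗ (a ⊗ u)`. -/
def swapOut (M N : Type*) [AddCommMonoid M] [Module k M] [AddCommMonoid N] [Module k N] :
    QAlg R ⊗[k] (M ⊗[k] N) →ₗ[k] N ⊗[k] (QAlg R ⊗[k] M) :=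
  (TensorProduct.comm k (QAlg R ⊗[k] M) N).toLinearMap ∘ₗ
    (TensorProduct.assoc k (QAlg R) M N).symm.toLinearMap

/-- `a ⊗ u v ↦ v ⊗ a ⊗ u`, where `u v ∈ W_p` is cut after the `i` letters of `u`; used for
`p = i + j`. -/
def rotate (p i j : ℕ) : Chains R p →ₗ[k] Gen R j i :=
  swapOut R (W R i) (W R j) ∘ₗ (cutW R p i j).lTensor (QAlg R)

variable {R}

@[simp]
theorem swapOut_tmul {M N : Type*} [AddCommMonoid M] [Module k M] [AddCommMonoid N] [Module k N]
    (a : QAlg R) (u : M) (v : N) : swapOut R M N (a ⊗ₜ (u ⊗ₜ v)) = v ⊗ₜ (a ⊗ₜ u) := rfl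

theorem rotate_tmul (p i j : ℕ) (a : QAlg R) (w : W R p) :
    rotate R p i j (a ⊗ₜ w) = swapOut R _ _ (a ⊗ₜ cutW R p i j w) := rfl

/-- Moving the last letter of `w` into `A` and rotating commute. -/
theorem genInR_rotate {p i j : ℕ} (hp : i + j = p) (z : Chains R (p + 1)) :
    genInR R j i (rotate R (p + 1) i (j + 1) z) = rotate R p i j (actCyc R (eA R) p z) := by
  suffices genInR R j i ∘ₗ rotate R (p + 1) i (j + 1) = rotate R p i j ∘ₗ actCyc R (eA R) p from
    LinearMap.congr_fun this z
  refine TensorProduct.ext' fun a w => ?_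
  let Φ : W R i ⊗[k] (W R j ⊗[k] V) →ₗ[k] Gen R j i :=
    (TensorProduct.assoc k _ _ _).toLinearMap ∘ₗ (TensorProduct.comm k _ _).toLinearMap ∘ₗ
      (((LinearMap.mul k (QAlg R)).flip a ∘ₗ eA R).lTensor (W R j)).lTensor (W R i)
  have h1 : ∀ ζ, genInR R j i (swapOut R _ _ (a ⊗ₜ ζ))
      = Φ ((lastLetter R j).lTensor (W R i) ζ) := by
    intro ζ
    induction ζ using TensorProduct.induction_on with
    | zero => simp
    | add y z hy hz => simp only [map_add, TensorProduct.tmul_add, hy, hz]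
    | tmul u v =>
      obtain ⟨S, hS⟩ := TensorProduct.exists_finset (lastLetter R j v)
      simp [genInR_tmul, actR_tmul, hS, moveR_tmul, Φ, TensorProduct.sum_tmul,
        TensorProduct.tmul_sum]
  have h0 : ∀ (ζ : W R i ⊗[k] W R j) (y : V), swapOut R _ _ ((eA R y * a) ⊗ₜ ζ)
      = Φ (TensorProduct.assoc k _ _ _ (ζ ⊗ₜ y)) := by
    intro ζ y
    induction ζ using TensorProduct.induction_on with
    | zero => simp
    | add y z hy hz => simp only [map_add, TensorProduct.tmul_add, TensorProduct.add_tmul, hy, hz]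
    | tmul u v => simp [Φ]
  have h2 : ∀ ζ, rotate R p i j (TensorProduct.comm k _ _ (moveR R (eA R) _ (ζ ⊗ₜ a)))
      = Φ (TensorProduct.assoc k _ _ _ ((cutW R p i j).rTensor V ζ)) := by
    intro ζ
    induction ζ using TensorProduct.induction_on with
    | zero => simp
    | add y z hy hz => simp only [map_add, TensorProduct.add_tmul, hy, hz]
    | tmul u v => simp [moveR_tmul, rotate_tmul, h0]
  clear_value Φ
  rw [LinearMap.comp_apply, rotate_tmul, h1, cutW_last hp, LinearMap.comp_apply, actCyc_tmul, h2]

/-- Moving the first letter of `w` into `A` and rotating commute. -/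
theorem genInL_rotate {p i j : ℕ} (hp : i + j = p) (z : Chains R (p + 1)) :
    genInL R j i (rotate R (p + 1) (i + 1) j z) = rotate R p i j (actL R (eA R) p z) := by
  suffices genInL R j i ∘ₗ rotate R (p + 1) (i + 1) j = rotate R p i j ∘ₗ actL R (eA R) p from
    LinearMap.congr_fun this z
  refine TensorProduct.ext' fun a w => ?_
  let Φ : (V ⊗[k] W R i) ⊗[k] W R j →ₗ[k] Gen R j i :=
    (TensorProduct.comm k _ _).toLinearMap ∘ₗ
      ((LinearMap.mul k (QAlg R) a ∘ₗ eA R).rTensor (W R i)).rTensor (W R j)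
  have h1 : ∀ ζ, genInL R j i (swapOut R _ _ (a ⊗ₜ ζ))
      = Φ ((firstLetter R i).rTensor (W R j) ζ) := by
    intro ζ
    induction ζ using TensorProduct.induction_on with
    | zero => simp
    | add y z hy hz => simp only [map_add, TensorProduct.tmul_add, hy, hz]
    | tmul u v =>
      obtain ⟨S, hS⟩ := TensorProduct.exists_finset (firstLetter R i u)
      simp [genInL_tmul, actL_tmul, hS, moveL_tmul, Φ, TensorProduct.sum_tmul,
        TensorProduct.tmul_sum]
  have h0 : ∀ (x : V) (ζ : W R i ⊗[k] W R j), swapOut R _ _ ((a * eA R x) ⊗ₜ ζ)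
      = Φ ((TensorProduct.assoc k _ _ _).symm (x ⊗ₜ ζ)) := by
    intro x ζ
    induction ζ using TensorProduct.induction_on with
    | zero => simp
    | add y z hy hz => simp only [map_add, TensorProduct.tmul_add, hy, hz]
    | tmul u v => simp [Φ]
  have h2 : ∀ ζ, rotate R p i j (moveL R (eA R) _ (a ⊗ₜ ζ))
      = Φ ((TensorProduct.assoc k _ _ _).symm ((cutW R p i j).lTensor V ζ)) := by
    intro ζ
    induction ζ using TensorProduct.induction_on with
    | zero => simp
    | add y z hy hz => simp only [map_add, TensorProduct.tmul_add, hy, hz]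
    | tmul u v => simp [moveL_tmul, rotate_tmul, h0]
  clear_value Φ
  rw [LinearMap.comp_apply, rotate_tmul, h1, cutW_first hp, LinearMap.comp_apply, actL_tmul, h2]

/-- A letter at the cut may be read as the first letter of the right part or as the last letter of
the left part; after rotation it leaves on the left, respectively on the right. -/
theorem outL_rotate {p i j q : ℕ} (hp : i + j = p) {N : Type*} [AddCommMonoid N] [Module k N]
    {κ κ' : KBim R q →ₗ[k] N} (h : ∀ x ζ, κ (lact R q (eA R x) ζ) = κ' (ract R q (eA R x) ζ))
    (g : Gen R j i →ₗ[k] KBim R q) (z : Chains R (p + 1)) :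
    κ (outL g (rotate R (p + 1) i (j + 1) z)) = κ' (outR g (rotate R (p + 1) (i + 1) j z)) := by
  suffices κ ∘ₗ outL g ∘ₗ rotate R (p + 1) i (j + 1) = κ' ∘ₗ outR g ∘ₗ rotate R (p + 1) (i + 1) j
    from LinearMap.congr_fun this z
  refine TensorProduct.ext' fun a w => ?_
  let Φ : W R i ⊗[k] (V ⊗[k] W R j) →ₗ[k] N :=
    κ ∘ₗ letterL g ∘ₗ ((TensorProduct.mk k (QAlg R) (W R i) a).lTensor (W R j)).lTensor V ∘ₗ
      (TensorProduct.assoc k _ _ _).toLinearMap ∘ₗ (TensorProduct.comm k _ _).toLinearMap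
  have h1 : ∀ ζ, κ (outL g (swapOut R _ _ (a ⊗ₜ ζ)))
      = Φ ((firstLetter R j).lTensor (W R i) ζ) := by
    intro ζ
    induction ζ using TensorProduct.induction_on with
    | zero => simp
    | add y z hy hz => simp only [map_add, TensorProduct.tmul_add, hy, hz]
    | tmul u v =>
      obtain ⟨S, hS⟩ := TensorProduct.exists_finset (firstLetter R j v)
      simp [outL_tmul, hS, Φ, TensorProduct.tmul_sum]
  have h2 : ∀ ζ, κ' (outR g (swapOut R _ _ (a ⊗ₜ ζ)))
      = Φ (TensorProduct.assoc k _ _ _ ((lastLetter R i).rTensor (W R j) ζ)) := by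
    intro ζ
    induction ζ using TensorProduct.induction_on with
    | zero => simp
    | add y z hy hz => simp only [map_add, TensorProduct.tmul_add, hy, hz]
    | tmul u v =>
      obtain ⟨S, hS⟩ := TensorProduct.exists_finset (lastLetter R i u)
      simp [outR_tmul, hS, Φ, TensorProduct.sum_tmul, h]
  clear_value Φ
  rw [LinearMap.comp_apply, LinearMap.comp_apply, rotate_tmul, h1, cutW_first_last hp,
    LinearMap.comp_apply, LinearMap.comp_apply, rotate_tmul, h2]

/-! ### Signed sums over the rotations -/

/-- The signed sum `∑_{i+j=p} (-1)^{ij} κ_j(g_{ji}(v ⊗ a ⊗ u))` over all ways of cutting `w = u v`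
with `u ∈ W_i` and `v ∈ W_j`. -/
def cycSum {q : ℕ} {N : Type*} [AddCommMonoid N] [Module k N] (κ : ℕ → KBim R q →ₗ[k] N)
    (g : ∀ i j, Gen R i j →ₗ[k] KBim R q) (p : ℕ) (z : Chains R p) : N :=
  ∑ x ∈ Finset.HasAntidiagonal.antidiagonal p,
    (-1 : k) ^ (x.1 * x.2) • κ x.2 (g x.2 x.1 (rotate R p x.1 x.2 z))

/-- The signed sums intertwine the differential of `K(A) ⊗_A K(A)` with that of Koszul chains. The
terms where a letter leaves the generator cancel: at the cut, the letter leaving on the left in one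
summand leaves on the right in the next one, with the opposite sign. -/
theorem cycSum_pre {q : ℕ} {N : Type*} [AddCommMonoid N] [Module k N] (κ : ℕ → KBim R q →ₗ[k] N)
    (hκ : ∀ j x ζ, κ (j + 1) (lact R q (eA R x) ζ) = κ j (ract R q (eA R x) ζ))
    (g : ∀ i j, Gen R i j →ₗ[k] KBim R q) (p : ℕ) (z : Chains R (p + 1)) :
    cycSum κ (pre g) (p + 1) z = cycSum κ g p (actL R (eA R) p z) +
      (-1 : k) ^ (p + 1) • cycSum (fun j => κ (j + 1)) g p (actCyc R (eA R) p z) := by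
  have hL : cycSum κ (preL g) (p + 1) z = ∑ x ∈ Finset.HasAntidiagonal.antidiagonal p,
      (-1 : k) ^ (x.1 * (x.2 + 1)) • κ (x.2 + 1)
        (preL g (x.2 + 1) x.1 (rotate R (p + 1) x.1 (x.2 + 1) z)) := by
    rw [cycSum, Finset.Nat.sum_antidiagonal_succ']
    simp [preL]
  have hR : cycSum κ (preR g) (p + 1) z = ∑ x ∈ Finset.HasAntidiagonal.antidiagonal p,
      (-1 : k) ^ ((x.1 + 1) * x.2) • κ x.2
        (preR g x.2 (x.1 + 1) (rotate R (p + 1) (x.1 + 1) x.2 z)) := by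
    rw [cycSum, Finset.Nat.sum_antidiagonal_succ]
    simp [preR]
  have hadd : cycSum κ (pre g) (p + 1) z
      = cycSum κ (preL g) (p + 1) z + cycSum κ (preR g) (p + 1) z := by
    simp only [cycSum, pre, Pi.add_apply, LinearMap.add_apply, map_add, smul_add,
      Finset.sum_add_distrib]
  rw [hadd, hL, hR, cycSum, cycSum, Finset.smul_sum, ← Finset.sum_add_distrib,
    ← Finset.sum_add_distrib]
  refine Finset.sum_congr rfl fun x hx => ?_
  obtain ⟨i, j⟩ := x
  have hp : i + j = p := by simpa using hx
  simp only [preL, preR, LinearMap.add_apply, LinearMap.smul_apply, LinearMap.comp_apply, map_add,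
    map_smul, genInR_rotate hp, genInL_rotate hp, outL_rotate hp (hκ j)]
  have e1 : (-1 : k) ^ (i * (j + 1)) = (-1) ^ (i * j) * (-1) ^ i := by ring
  have e2 : (-1 : k) ^ ((i + 1) * j) = (-1) ^ (i * j) * (-1) ^ j := by ring
  have e3 : (-1 : k) ^ (p + 1) = (-1) ^ i * (-1) ^ (j + 1) := by rw [← hp]; ring
  rw [e1, e2, e3]
  -- only `((-1)^j)^2 = 1` is needed to compare the coefficients
  rcases neg_one_pow_eq_or k j with hj | hj <;> rw [pow_succ, hj] <;> module

theorem augDiff_succ_succ (p i j : ℕ) : augDiff R p (i + 1) (j + 1) = 0 :=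
  Gen_ext fun w a w' => by simp [augDiff_tmul, counit_succ]

/-- Only the two trivial cuts contribute to the signed sum of the augmentations. -/
theorem cycSum_augDiff (p : ℕ) {N : Type*} [AddCommMonoid N] [Module k N]
    (κ : ℕ → KBim R (p + 1) →ₗ[k] N) (a : QAlg R) (w : W R (p + 1)) :
    cycSum κ (augDiff R (p + 1)) (p + 1) (a ⊗ₜ w)
      = κ 0 ((a ⊗ₜ w) ⊗ₜ 1) + (-1 : k) • κ (p + 1) ((1 ⊗ₜ w) ⊗ₜ a) := by
  rw [cycSum, Finset.Nat.sum_antidiagonal_succ, Finset.sum_eq_single (p, 0)]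
  · simp only [rotate_tmul, cutW_zero_left, cutW_zero_right, swapOut_tmul, augDiff_tmul,
      counit_succ, counit_unitW, same_self, LinearMap.id_apply, zero_smul, smul_zero, one_smul,
      zero_add, add_zero, mul_zero, zero_mul, pow_zero, map_smul]
    exact add_comm _ _
  · rintro ⟨i, j⟩ hx hne
    match j with
    | 0 =>
      refine absurd ?_ hne
      have : i = p := by simpa using hx
      rw [this]
    | j + 1 => simp [augDiff_succ_succ]
  · simp

/-! ### The Connes-type operator on Koszul chains and its homotopy -/

theorem cycSum_add {q : ℕ} {N : Type*} [AddCommMonoid N] [Module k N]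
    (κ : ℕ → KBim R q →ₗ[k] N) (f g : ∀ i j, Gen R i j →ₗ[k] KBim R q) (p : ℕ) (z : Chains R p) :
    cycSum κ (f + g) p z = cycSum κ f p z + cycSum κ g p z := by
  simp only [cycSum, Pi.add_apply, LinearMap.add_apply, map_add, smul_add, Finset.sum_add_distrib]

theorem cycSum_smul {q : ℕ} {N : Type*} [AddCommMonoid N] [Module k N]
    (κ : ℕ → KBim R q →ₗ[k] N) (c : k) (g : ∀ i j, Gen R i j →ₗ[k] KBim R q) (p : ℕ)
    (z : Chains R p) : cycSum κ (c • g) p z = c • cycSum κ g p z := by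
  simp only [cycSum, Pi.smul_apply, LinearMap.smul_apply, map_smul, Finset.smul_sum,
    smul_comm c]

theorem cycSum_map_add {q : ℕ} {N : Type*} [AddCommMonoid N] [Module k N]
    (κ : ℕ → KBim R q →ₗ[k] N) (g : ∀ i j, Gen R i j →ₗ[k] KBim R q) (p : ℕ) (y z : Chains R p) :
    cycSum κ g p (y + z) = cycSum κ g p y + cycSum κ g p z := by
  simp only [cycSum, map_add, smul_add, Finset.sum_add_distrib]

theorem cycSum_map_smul {q : ℕ} {N : Type*} [AddCommMonoid N] [Module k N]
    (κ : ℕ → KBim R q →ₗ[k] N) (g : ∀ i j, Gen R i j →ₗ[k] KBim R q) (p : ℕ) (c : k)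
    (z : Chains R p) : cycSum κ g p (c • z) = c • cycSum κ g p z := by
  simp only [cycSum, map_smul, Finset.smul_sum, smul_comm c]

theorem cycSum_add_left {q : ℕ} {N : Type*} [AddCommMonoid N] [Module k N]
    (κ κ' : ℕ → KBim R q →ₗ[k] N) (g : ∀ i j, Gen R i j →ₗ[k] KBim R q) (p : ℕ) (z : Chains R p) :
    cycSum (fun j => κ j + κ' j) g p z = cycSum κ g p z + cycSum κ' g p z := by
  simp only [cycSum, LinearMap.add_apply, smul_add, Finset.sum_add_distrib]

theorem map_cycSum {q : ℕ} {N N' : Type*} [AddCommMonoid N] [Module k N] [AddCommMonoid N']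
    [Module k N'] (f : N →ₗ[k] N') (κ : ℕ → KBim R q →ₗ[k] N)
    (g : ∀ i j, Gen R i j →ₗ[k] KBim R q) (p : ℕ) (z : Chains R p) :
    f (cycSum κ g p z) = cycSum (fun j => f ∘ₗ κ j) g p z := by
  simp only [cycSum, map_sum, map_smul, LinearMap.comp_apply]

theorem cycSum_post {q : ℕ} {N : Type*} [AddCommMonoid N] [Module k N]
    (κ : ℕ → KBim R q →ₗ[k] N) (g : ∀ i j, Gen R i j →ₗ[k] KBim R (q + 1)) (p : ℕ)
    (z : Chains R p) : cycSum κ (post g) p z = cycSum (fun j => κ j ∘ₗ dKBim R q) g p z := rfl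

variable (R) in
/-- `a ⊗ w ⊗ b ↦ j b a ⊗ w + D(b) a ⊗ w` with the Euler derivation `D`. It counts the letters of
`b` and of a word of length `j`. -/
def closeCount (q j : ℕ) : KBim R q →ₗ[k] Chains R q :=
  (j : k) • close R LinearMap.id q + close R (euler R) q

theorem close_id_lact (q : ℕ) (a : QAlg R) (z : KBim R q) :
    close R LinearMap.id q (lact R q a z) = close R LinearMap.id q (ract R q a z) := by
  have : close R LinearMap.id q ∘ₗ lact R q a = close R LinearMap.id q ∘ₗ ract R q a :=
    KBim_ext fun α w β => by simp [mul_assoc]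
  exact LinearMap.congr_fun this z

theorem closeCount_lact (q j : ℕ) (x : V) (z : KBim R q) :
    closeCount R q (j + 1) (lact R q (eA R x) z) = closeCount R q j (ract R q (eA R x) z) := by
  have : closeCount R q (j + 1) ∘ₗ lact R q (eA R x) = closeCount R q j ∘ₗ ract R q (eA R x) := by
    refine KBim_ext fun α w β => ?_
    simp only [closeCount, LinearMap.comp_apply, LinearMap.add_apply, LinearMap.smul_apply,
      lact_tmul, ract_tmul, close_tmul, LinearMap.id_apply, euler_mul, euler_eA, add_mul,
      TensorProduct.add_tmul, mul_assoc]
    push_cast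
    module
  exact LinearMap.congr_fun this z

theorem closeCount_succ (q j : ℕ) :
    closeCount R q (j + 1) = closeCount R q j + close R LinearMap.id q := by
  simp only [closeCount]
  push_cast
  module

variable (R) in
/-- The operator `B(a ⊗ w) = ∑ ± κ(h(v ⊗ a ⊗ u))` of degree one on Koszul chains, where `w = u v`
and `κ(a ⊗ w ⊗ b) = b a ⊗ w`; it plays the role of Connes' operator. -/
def connes (p : ℕ) : Chains R p → Chains R (p + 1) :=
  cycSum (fun _ => close R LinearMap.id (p + 1)) (augHomotopy R p) p

variable (R) in
/-- The operator which exhibits the number of letters as the commutator, up to homotopy, of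
Connes' operator and the cap product. -/
def connesHomotopy (p : ℕ) : Chains R p → Chains R (p + 1) :=
  cycSum (closeCount R (p + 1)) (augHomotopy R p) p

/-- Connes' operator anticommutes with the Koszul differential. -/
theorem bK_connes (hR : IsKoszul R) (p : ℕ) (z : Chains R (p + 1)) :
    bK R (p + 1) (connes R (p + 1) z) + connes R p (bK R p z) = 0 := by
  have h1 : cycSum (fun _ => close R LinearMap.id (p + 1)) (augDiff R (p + 1)) (p + 1) z = 0 := by
    induction z using TensorProduct.induction_on with
    | zero => simp [cycSum]
    | add y z hy hz => rw [cycSum_map_add, hy, hz, add_zero]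
    | tmul a w =>
      rw [cycSum_augDiff]
      simp only [close_tmul, LinearMap.id_apply, one_mul, mul_one]
      module
  have h2 : (fun _ : ℕ => bK R (p + 1) ∘ₗ close R LinearMap.id (p + 1 + 1))
      = fun _ => close R LinearMap.id (p + 1) ∘ₗ dKBim R (p + 1) :=
    funext fun _ => LinearMap.ext fun y => (close_id_dKBim (p + 1) y).symm
  rw [connes, map_cycSum, h2, ← cycSum_post, post_augHomotopy_succ hR, cycSum_add, cycSum_smul,
    cycSum_pre _ (fun _ x ζ => close_id_lact _ _ _), h1, connes, bK, LinearMap.add_apply,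
    LinearMap.smul_apply, cycSum_map_add, cycSum_map_smul]
  module

variable (R) in
/-- Multiplication of a Koszul chain by its total number of letters. -/
def weight (p : ℕ) : Chains R p →ₗ[k] Chains R p :=
  (euler R).rTensor (W R p) + (p : k) • LinearMap.id

/-- The Rinehart-type homotopy formula: in positive degree, multiplication by the number of
letters is homotopic to the commutator of the cap product and Connes' operator. -/
theorem weight_eq (hR : IsKoszul R) (p : ℕ) (z : Chains R (p + 1)) :
    weight R (p + 1) z + bK R (p + 1) (connesHomotopy R (p + 1) z) +
      connesHomotopy R p (bK R p z) +
      (-1 : k) ^ (p + 1) • connes R p (actCyc R (eA R) p z) +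
      (-1 : k) ^ (p + 1 + 1) • actCyc R (eA R) (p + 1) (connes R (p + 1) z) = 0 := by
  have h1 : cycSum (closeCount R (p + 1)) (augDiff R (p + 1)) (p + 1) z
      + weight R (p + 1) z = 0 := by
    induction z using TensorProduct.induction_on with
    | zero => simp [cycSum]
    | add y z hy hz =>
      rw [cycSum_map_add, map_add, add_add_add_comm, hy, hz, add_zero]
    | tmul a w =>
      rw [cycSum_augDiff]
      simp only [weight, closeCount, LinearMap.add_apply, LinearMap.smul_apply, close_tmul,
        LinearMap.id_apply, one_mul, mul_one, euler_one, zero_mul, TensorProduct.zero_tmul,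
        LinearMap.rTensor_tmul]
      push_cast
      module
  have h2 : bK R (p + 1) (connesHomotopy R (p + 1) z) +
      (-1 : k) ^ (p + 1 + 1) • actCyc R (eA R) (p + 1) (connes R (p + 1) z)
      = cycSum (closeCount R (p + 1)) (post (augHomotopy R (p + 1))) (p + 1) z := by
    rw [connesHomotopy, map_cycSum, connes, map_cycSum, cycSum_post]
    have h4 : ∀ j, closeCount R (p + 1) j ∘ₗ dKBim R (p + 1)
        = bK R (p + 1) ∘ₗ closeCount R (p + 1 + 1) j + (-1 : k) ^ (p + 1 + 1) •
          actCyc R (eA R) (p + 1) ∘ₗ close R LinearMap.id (p + 1 + 1) := by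
      intro j
      refine LinearMap.ext fun y => ?_
      simp only [closeCount, LinearMap.comp_apply, LinearMap.add_apply, LinearMap.smul_apply,
        close_id_dKBim, close_euler_dKBim, map_add, map_smul]
      module
    simp only [h4, cycSum, LinearMap.add_apply, LinearMap.smul_apply, smul_add,
      Finset.sum_add_distrib, Finset.smul_sum]
    congr 1
    exact Finset.sum_congr rfl fun _ _ => smul_comm _ _ _
  rw [post_augHomotopy_succ hR, cycSum_add, cycSum_smul,
    cycSum_pre _ (fun j x ζ => closeCount_lact _ _ _ _)] at h2
  have h5 : cycSum (fun j => closeCount R (p + 1) (j + 1)) (augHomotopy R p) p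
        (actCyc R (eA R) p z)
      = connesHomotopy R p (actCyc R (eA R) p z) + connes R p (actCyc R (eA R) p z) := by
    simp only [closeCount_succ, cycSum_add_left]
    rfl
  have h6 : connesHomotopy R p (bK R p z) = connesHomotopy R p (actL R (eA R) p z) +
      (-1 : k) ^ (p + 1) • connesHomotopy R p (actCyc R (eA R) p z) := by
    rw [bK, LinearMap.add_apply, LinearMap.smul_apply, connesHomotopy, cycSum_map_add,
      cycSum_map_smul]
  rw [h5] at h2
  rw [h6]
  change _ = _ + (-1 : k) • (connesHomotopy R p (actL R (eA R) p z) + _) at h2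
  generalize bK R (p + 1) (connesHomotopy R (p + 1) z) = x1 at *
  generalize (-1 : k) ^ (p + 1 + 1) • actCyc R (eA R) (p + 1) (connes R (p + 1) z) = x2 at *
  calc _ = weight R (p + 1) z + (x1 + x2) + (connesHomotopy R p (actL R (eA R) p z) +
      (-1 : k) ^ (p + 1) • (connesHomotopy R p (actCyc R (eA R) p z) +
        connes R p (actCyc R (eA R) p z))) := by module
    _ = cycSum (closeCount R (p + 1)) (augDiff R (p + 1)) (p + 1) z + weight R (p + 1) z := by
        rw [h2]; module
    _ = 0 := h1

end

section

variable {R : Submodule k (V ⊗[k] V)}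

/-! ### Higher Koszul homology in positive degree -/

theorem weight_tmul (p : ℕ) (a : QAlg R) (w : W R p) :
    weight R p (a ⊗ₜ w) = (euler R a + (p : k) • a) ⊗ₜ w := by
  simp [weight, TensorProduct.add_tmul, TensorProduct.smul_tmul']

theorem weight_actL (p : ℕ) (z : Chains R (p + 1)) :
    weight R p (actL R (eA R) p z) = actL R (eA R) p (weight R (p + 1) z) := by
  induction z using TensorProduct.induction_on with
  | zero => simp
  | add y z hy hz => simp only [map_add, hy, hz]
  | tmul a w =>
    rw [weight_tmul, actL_tmul, actL_tmul]
    generalize firstLetter R p w = ζ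
    induction ζ using TensorProduct.induction_on with
    | zero => simp
    | add y z hy hz => simp only [map_add, TensorProduct.tmul_add, hy, hz]
    | tmul x u =>
      rw [moveL_tmul, moveL_tmul, weight_tmul, euler_mul, euler_eA, add_mul, smul_mul_assoc]
      congr 1
      push_cast
      module

theorem weight_actCyc (p : ℕ) (z : Chains R (p + 1)) :
    weight R p (actCyc R (eA R) p z) = actCyc R (eA R) p (weight R (p + 1) z) := by
  induction z using TensorProduct.induction_on with
  | zero => simp
  | add y z hy hz => simp only [map_add, hy, hz]
  | tmul a w =>
    rw [weight_tmul, actCyc_tmul, actCyc_tmul]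
    generalize lastLetter R p w = ζ
    induction ζ using TensorProduct.induction_on with
    | zero => simp
    | add y z hy hz => simp only [map_add, TensorProduct.add_tmul, hy, hz]
    | tmul u x =>
      rw [moveR_tmul, moveR_tmul, TensorProduct.comm_tmul, TensorProduct.comm_tmul, weight_tmul,
        euler_mul, euler_eA, mul_add, mul_smul_comm]
      congr 1
      push_cast
      module

theorem weight_bK (p : ℕ) (z : Chains R (p + 1)) :
    weight R p (bK R p z) = bK R p (weight R (p + 1) z) := by
  simp only [bK, LinearMap.add_apply, LinearMap.smul_apply, map_add, map_smul, weight_actL,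
    weight_actCyc]

theorem weight_capL (p : ℕ) (z : Chains R (p + 1)) :
    weight R p (capL R (eA R) p z) = capL R (eA R) p (weight R (p + 1) z) := by
  simp only [capL, LinearMap.smul_apply, map_smul, weight_actCyc]

/-- In positive degree the number of letters acts locally finitely, with positive integers as
eigenvalues. -/
theorem exists_aeval_weight_eq_zero [CharZero k] (p : ℕ) (z : Chains R (p + 1)) :
    ∃ q : Polynomial k, q.coeff 0 ≠ 0 ∧ Polynomial.aeval (weight R (p + 1)) q z = 0 := by
  induction z using TensorProduct.induction_on with
  | zero => exact ⟨1, by simp, by simp⟩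
  | add y z hy hz =>
    obtain ⟨f, hf, hfy⟩ := hy
    obtain ⟨g, hg, hgz⟩ := hz
    refine ⟨f * g, by rw [Polynomial.mul_coeff_zero]; exact mul_ne_zero hf hg, ?_⟩
    have h1 : Polynomial.aeval (weight R (p + 1)) (f * g) y = 0 := by
      rw [mul_comm, map_mul, Module.End.mul_apply, hfy, map_zero]
    have h2 : Polynomial.aeval (weight R (p + 1)) (f * g) z = 0 := by
      rw [map_mul, Module.End.mul_apply, hgz, map_zero]
    rw [map_add, h1, h2, add_zero]
  | tmul a w =>
    induction a using QAlg.word_induction with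
    | word n t ht =>
      refine ⟨Polynomial.X - Polynomial.C ((n : k) + ((p + 1 : ℕ) : k)), ?_, ?_⟩
      · rw [Polynomial.coeff_sub, Polynomial.coeff_X_zero, Polynomial.coeff_C_zero, zero_sub,
          neg_ne_zero, ← Nat.cast_add]
        exact_mod_cast Nat.succ_ne_zero (n + p)
      · rw [map_sub, Polynomial.aeval_X, Polynomial.aeval_C, LinearMap.sub_apply, weight_tmul,
          euler_proj ht, Module.algebraMap_end_apply, ← add_smul, TensorProduct.smul_tmul',
          sub_self]
    | add a b ha hb =>
      obtain ⟨f, hf, hfy⟩ := ha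
      obtain ⟨g, hg, hgz⟩ := hb
      refine ⟨f * g, by rw [Polynomial.mul_coeff_zero]; exact mul_ne_zero hf hg, ?_⟩
      have h1 : Polynomial.aeval (weight R (p + 1)) (f * g) (a ⊗ₜ w) = 0 := by
        rw [mul_comm, map_mul, Module.End.mul_apply, hfy, map_zero]
      have h2 : Polynomial.aeval (weight R (p + 1)) (f * g) (b ⊗ₜ w) = 0 := by
        rw [map_mul, Module.End.mul_apply, hgz, map_zero]
      rw [TensorProduct.add_tmul, map_add, h1, h2, add_zero]

/-- If an endomorphism `E` maps an `E`-stable subspace `Z` into `T`, then `T` contains every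
element of `Z` killed by a polynomial in `E` with nonzero constant term. -/
theorem mem_of_aeval_eq_zero {M : Type*} [AddCommGroup M] [Module k M] (E : Module.End k M)
    (Z T : Submodule k M) (hZ : ∀ z ∈ Z, E z ∈ Z) (hT : ∀ z ∈ Z, E z ∈ T) {z : M} (hz : z ∈ Z)
    {q : Polynomial k} (hq : q.coeff 0 ≠ 0) (h : Polynomial.aeval E q z = 0) : z ∈ T := by
  have hpoly : ∀ f : Polynomial k, Polynomial.aeval E f z ∈ Z := by
    intro f
    induction f using Polynomial.induction_on' with
    | add f g hf hg =>
      rw [map_add, LinearMap.add_apply]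
      exact add_mem hf hg
    | monomial n c =>
      rw [Polynomial.aeval_monomial, Module.End.mul_apply, Module.algebraMap_end_apply]
      refine Z.smul_mem c ?_
      induction n with
      | zero => simpa using hz
      | succ n ih => rw [pow_succ', Module.End.mul_apply]; exact hZ _ ih
  rw [← Polynomial.X_mul_divX_add q, map_add, map_mul, Polynomial.aeval_X, Polynomial.aeval_C,
    LinearMap.add_apply, Module.End.mul_apply, Module.algebraMap_end_apply] at h
  have h1 : q.coeff 0 • z ∈ T := by
    rw [eq_neg_of_add_eq_zero_right h]
    exact neg_mem (hT _ (hpoly _))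
  exact (T.smul_mem_iff hq).mp h1

variable (R) in
/-- The chains which are, up to a boundary, the cap product of `e_A` with a cycle. -/
def capBoundaries (p : ℕ) : Submodule k (Chains R p) :=
  (LinearMap.ker (bK R p)).map (capL R (eA R) p) ⊔ LinearMap.range (bK R p)

theorem weight_mem_capBoundaries (hR : IsKoszul R) (p : ℕ) (z : Chains R (p + 1))
    (hz : bK R p z = 0) (hcap : capL R (eA R) p z ∈ LinearMap.range (bK R p)) :
    weight R (p + 1) z ∈ capBoundaries R (p + 1) := by
  have hzero : ∀ p, connes R p 0 = 0 := fun p => by simp [connes, cycSum]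
  have hzero' : ∀ p, connesHomotopy R p 0 = 0 := fun p => by simp [connesHomotopy, cycSum]
  obtain ⟨y, hy⟩ := hcap
  have hcyc : bK R (p + 1) (connes R (p + 1) z) = 0 := by
    have h := bK_connes hR p z
    rwa [hz, hzero, add_zero] at h
  have h1 : actCyc R (eA R) p z = bK R p ((-1 : k) ^ p • y) := by
    rw [map_smul, hy, capL, LinearMap.smul_apply, smul_smul, ← mul_pow]
    simp
  have h2 : connes R p (actCyc R (eA R) p z) ∈ LinearMap.range (bK R (p + 1)) := by
    refine ⟨-connes R (p + 1) ((-1 : k) ^ p • y), ?_⟩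
    rw [h1, map_neg]
    exact neg_eq_of_add_eq_zero_right (bK_connes hR p _)
  have h3 := weight_eq hR p z
  rw [hz, hzero', add_zero] at h3
  have h4 : weight R (p + 1) z = -((-1 : k) ^ (p + 1) • connes R p (actCyc R (eA R) p z) +
      bK R (p + 1) (connesHomotopy R (p + 1) z)) + capL R (eA R) (p + 1) (connes R (p + 1) z) := by
    rw [capL, LinearMap.smul_apply, ← sub_eq_zero, ← h3, pow_succ _ (p + 1)]
    module
  rw [h4]
  refine add_mem (Submodule.mem_sup_right (neg_mem (add_mem ?_ ⟨_, rfl⟩)))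
    (Submodule.mem_sup_left ⟨_, hcyc, rfl⟩)
  exact Submodule.smul_mem _ _ h2

theorem mem_capBoundaries [CharZero k] (hR : IsKoszul R) (p : ℕ) (z : Chains R (p + 1))
    (hz : bK R p z = 0) (hcap : capL R (eA R) p z ∈ LinearMap.range (bK R p)) :
    z ∈ capBoundaries R (p + 1) := by
  obtain ⟨q, hq, hqz⟩ := exists_aeval_weight_eq_zero p z
  -- the chains satisfying both hypotheses form a subspace stable under `weight`
  refine mem_of_aeval_eq_zero (M := Chains R (p + 1)) (weight R (p + 1))
    (LinearMap.ker (bK R p) ⊓ (LinearMap.range (bK R p)).comap (capL R (eA R) p)) _ ?_ ?_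
    ⟨hz, hcap⟩ hq hqz
  · rintro z ⟨hz, y, hy⟩
    have hz' : bK R p z = 0 := hz
    refine ⟨?_, weight R (p + 1) y, ?_⟩
    · change bK R p _ = 0
      rw [← weight_bK, hz', map_zero]
    · rw [← weight_bK, hy, weight_capL]
  · rintro z ⟨hz, hcap⟩
    exact weight_mem_capBoundaries hR p z hz hcap

theorem mk_mem_boundaries_iff (p : ℕ) (z : cycles (Chains R) (bK R) p) :
    (Submodule.Quotient.mk z : HK R p) ∈ boundaries (HK R) (partialCap R) p ↔
      (z : Chains R p) ∈ capBoundaries R p := by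
  constructor
  · rintro ⟨y, hy⟩
    obtain ⟨y, rfl⟩ := Submodule.mkQ_surjective _ y
    have h : capCycles R p y - z ∈
        (boundaries (Chains R) (bK R) p).submoduleOf (cycles (Chains R) (bK R) p) :=
      (Submodule.Quotient.eq _).mp hy
    rw [← sub_sub_cancel (capCycles R p y : Chains R p) z]
    exact sub_mem (Submodule.mem_sup_left ⟨y, y.2, rfl⟩) (Submodule.mem_sup_right h)
  · intro h
    obtain ⟨_, ⟨y, hy, rfl⟩, b, hb, hyb⟩ := Submodule.mem_sup.mp h
    refine ⟨Submodule.Quotient.mk ⟨y, hy⟩, (Submodule.Quotient.eq _).mpr ?_⟩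
    change capL R (eA R) p y - (z : Chains R p) ∈ LinearMap.range (bK R p)
    rw [← hyb, sub_add_cancel_left]
    exact neg_mem hb

/-- Higher Koszul homology of a Koszul algebra vanishes in positive degree. -/
theorem IsKoszul.subsingleton_HKhi [CharZero k] (hR : IsKoszul R) (p : ℕ) :
    Subsingleton (HKhi R (p + 1)) := by
  refine (subsingleton_homology_iff (HK R) (partialCap R) (p + 1)).mpr fun z hz => ?_
  obtain ⟨z, rfl⟩ := Submodule.mkQ_surjective _ z
  have h : capCycles R p z ∈
      (boundaries (Chains R) (bK R) p).submoduleOf (cycles (Chains R) (bK R) p) :=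
    (Submodule.Quotient.mk_eq_zero _).mp hz
  exact (mk_mem_boundaries_iff (p + 1) z).mpr (mem_capBoundaries hR p z z.2 h)

/-! ### Higher Koszul homology in degree zero -/

variable (R) in
/-- The augmentation `A ⊗ W_0 → k` of Koszul chains. -/
def augChains : Chains R 0 →ₗ[k] k :=
  LinearMap.mul' k k ∘ₗ TensorProduct.map (aug R).toLinearMap (counit R 0)

theorem augChains_actL (z : Chains R 1) : augChains R (actL R (eA R) 0 z) = 0 := by
  induction z using TensorProduct.induction_on with
  | zero => simp
  | add y z hy hz => rw [map_add, map_add, hy, hz, add_zero]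
  | tmul a w =>
    obtain ⟨v, hv⟩ := w.2
    simp [actL_tmul, firstLetter_ι v w hv.symm, moveL_tmul, augChains]

theorem augChains_actCyc (z : Chains R 1) : augChains R (actCyc R (eA R) 0 z) = 0 := by
  induction z using TensorProduct.induction_on with
  | zero => simp
  | add y z hy hz => rw [map_add, map_add, hy, hz, add_zero]
  | tmul a w =>
    obtain ⟨v, hv⟩ := w.2
    simp [actCyc_tmul, lastLetter_ι v w hv.symm, moveR_tmul, augChains]

theorem exists_eq_tmul_unitW (z : Chains R 0) : ∃ a, z = a ⊗ₜ unitW R := by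
  induction z using TensorProduct.induction_on with
  | zero => exact ⟨0, by simp⟩
  | add y z hy hz =>
    obtain ⟨a, rfl⟩ := hy
    obtain ⟨b, rfl⟩ := hz
    exact ⟨a + b, (TensorProduct.add_tmul _ _ _).symm⟩
  | tmul a w =>
    refine ⟨counit R 0 w • a, ?_⟩
    conv_lhs => rw [eq_counit_smul_unitW w]
    rw [TensorProduct.tmul_smul, TensorProduct.smul_tmul']

/-- `D(c)` is the cap product of `e_A` with a Koszul cycle, up to a commutator. If `c` is a word,
this cycle is, up to sign, the sum over the cyclic rotations of `c`, which splits off one letter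
of each rotation. -/
theorem euler_mem_capBoundaries (c : QAlg R) : euler R c ⊗ₜ unitW R ∈ capBoundaries R 0 := by
  obtain ⟨η, hη⟩ := exists_dKBim_eq c
  have h1 := close_id_dKBim 0 η
  have h2 := close_euler_dKBim 0 η
  rw [hη, map_add, map_smul] at h1 h2
  simp only [close_tmul, LinearMap.id_apply, one_mul, mul_one, euler_one, zero_mul,
    TensorProduct.zero_tmul, zero_add] at h1 h2
  have h3 : euler R c ⊗ₜ unitW R = capL R (eA R) 0 (close R LinearMap.id 1 η)
      + bK R 0 (-close R (euler R) 1 η) := by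
    calc euler R c ⊗ₜ unitW R = (-1 : k) • ((-1 : k) • euler R c ⊗ₜ[k] unitW R) := by module
      _ = _ := by
        rw [h2, capL, LinearMap.smul_apply, map_neg]
        module
  rw [h3]
  refine add_mem (Submodule.mem_sup_left ⟨_, ?_, rfl⟩) (Submodule.mem_sup_right ⟨_, rfl⟩)
  change bK R 0 _ = 0
  rw [← h1]
  module

theorem ker_augChains [CharZero k] : LinearMap.ker (augChains R) = capBoundaries R 0 := by
  apply le_antisymm
  · intro z hz
    obtain ⟨a, rfl⟩ := exists_eq_tmul_unitW z
    have ha : aug R a = 0 := by simpa [augChains] using hz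
    obtain ⟨c, hc⟩ := exists_euler_eq a
    rw [hc, ha, map_zero, zero_add]
    exact euler_mem_capBoundaries c
  · refine sup_le ?_ ?_
    · rintro _ ⟨y, -, rfl⟩
      rw [LinearMap.mem_ker, capL, LinearMap.smul_apply, map_smul, augChains_actCyc, smul_zero]
    · rintro _ ⟨y, rfl⟩
      rw [LinearMap.mem_ker, bK, LinearMap.add_apply, LinearMap.smul_apply, map_add, map_smul,
        augChains_actL, augChains_actCyc, smul_zero, add_zero]

/-- Homology in degree zero is the cokernel of the last differential. -/
theorem nonempty_homology_zero_equiv (C : ℕ → Type*) [∀ p, AddCommGroup (C p)]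
    [∀ p, Module k (C p)] (d : ∀ p, C (p + 1) →ₗ[k] C p) (f : C 0 →ₗ[k] k)
    (hf : Function.Surjective f) (hker : LinearMap.ker f = boundaries C d 0) :
    Nonempty (Homology C d 0 ≃ₗ[k] k) := by
  let g : cycles C d 0 →ₗ[k] k := f ∘ₗ (cycles C d 0).subtype
  have hg : Function.Surjective g := fun c => by
    obtain ⟨x, hx⟩ := hf c
    exact ⟨⟨x, trivial⟩, hx⟩
  have hk : (boundaries C d 0).submoduleOf (cycles C d 0) = LinearMap.ker g := by
    rw [← hker]
    rfl
  exact ⟨(Submodule.quotEquivOfEq _ _ hk).trans (g.quotKerEquivOfSurjective hg)⟩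

/-- `HK^{hi}_0(A)` is one-dimensional, spanned by the class of `1`. -/
theorem nonempty_HKhi_zero_equiv [CharZero k] : Nonempty (HKhi R 0 ≃ₗ[k] k) := by
  let g : cycles (Chains R) (bK R) 0 →ₗ[k] k := augChains R ∘ₗ (cycles (Chains R) (bK R) 0).subtype
  have hg : (boundaries (Chains R) (bK R) 0).submoduleOf (cycles (Chains R) (bK R) 0)
      ≤ LinearMap.ker g := fun z hz => by
    have : (z : Chains R 0) ∈ LinearMap.ker (augChains R) := by
      rw [ker_augChains]
      exact Submodule.mem_sup_right hz
    exact this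
  refine nonempty_homology_zero_equiv (HK R) (partialCap R) (Submodule.liftQ _ g hg) ?_ ?_
  · intro c
    refine ⟨Submodule.Quotient.mk ⟨c • (1 ⊗ₜ unitW R), trivial⟩, ?_⟩
    change augChains R (c • (1 ⊗ₜ unitW R)) = c
    simp [augChains]
  · ext z
    obtain ⟨z, rfl⟩ := Submodule.mkQ_surjective _ z
    refine Iff.trans ?_ (mk_mem_boundaries_iff 0 z).symm
    rw [← ker_augChains]
    rfl

end

end Quadratic

end

theorem mainTheorem4 {k : Type*} [Field k] [CharZero k] {V : Type*} [AddCommGroup V] [Module k V]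
    (R : Submodule k (TensorProduct k V V)) :
    Nonempty (Quadratic.HKhi R 0 ≃ₗ[k] k) ∧
      (Quadratic.IsKoszul R → ∀ p : ℕ, 0 < p → Subsingleton (Quadratic.HKhi R p)) := by
  refine ⟨Quadratic.nonempty_HKhi_zero_equiv, fun hR p hp => ?_⟩
  obtain ⟨q, rfl⟩ : ∃ q, p = q + 1 := ⟨p - 1, by omega⟩
  exact hR.subsingleton_HKhi q
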